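/- **Conventions.** A vector of $\mathbb Z^2$ is primitive if its coordinates are coprime. For linearly independent primitive $v_1,v_2\in\mathbb Z^2$ let $\sigma(v_1,v_2)$ be the oriented lattice cone generated by the ordered pair, $A_\sigma$ the matrix with columns $v_1,v_2$, $M_\sigma=\mathbb Zv_1+\mathbb Zv_2$, $\Gamma_\sigma=\mathbb Z^2/M_\sigma$, and $\chi_{\sigma,j}(g)=e^{2\pi\sqrt{-1}\,a_j(g)}$ for $g=a_1(g)v_1+a_2(g)v_2\in\Gamma_\sigma$. The cone is nonsingular if $\det A_\sigma=\pm1$; cones $\sigma,\tau$ are similar if $PA_\sigma=A_\tau$ for some $P\in GL_2(\mathbb Z)$. The dual cone is $\check\sigma=\sigma(u_1,u_2)$ with $u_j$ the primitive inward vector normal to $v_j$. Put $\mathrm{Todd}^\lambda(S)=\frac{S}{1-\lambda e^{-S}}\in\mathbb C[[S]]$, $$\mathrm{Todd}_\sigma(x_1,x_2)=\sum_{g\in\Gamma_\sigma}\mathrm{Todd}^{\chi_{\sigma,1}(g)}(x_1)\,\mathrm{Todd}^{\chi_{\sigma,2}(g)}(x_2)\in\mathbb C[[x_1,x_2]],\qquad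 S_\sigma=\frac{\mathrm{Todd}_\sigma}{\det(A_\sigma)x_1x_2},$$ and $F(y_1,y_2)=\frac1{1-e^{-y_1}}\frac1{1-e^{-y_2}}$; identities involving $F$ or $S_\sigma$ are in the fraction field of $\mathbb C[[x_1,x_2]]$. For pairwise linearly independent primitive vectors $w_0,\dots,w_n$ in a closed half plane we write formally $\sigma(w_0,w_n)=\sigma(w_0,w_1)+\dots+\sigma(w_{n-1},w_n)$ (a virtual decomposition). $B_n$ is the $n$-th Bernoulli number. **Setting.** Let $K$ be a real quadratic field with a fixed real embedding, and $\mathfrak b$ an integral ideal of $K$ with $\mathfrak b^{-1}=\mathbb Z+\mathbb Z\omega$, where $\omega=[[a_0,a_1,\dots,a_{r-1}]]$ has purely periodic regular continued fraction of minimal period $r$. Let $\ell=r$ if $r$ is even and $\ell=2r$ if $r$ is odd, and extend $(a_i)$ $r$-periodically. Define the convergent vectors $v_i=(\alpha_i,\beta_i)$ by $v_{-1}=(0,1)$ and, for $0\le i\le\ell-1$, $v_i=$ the first column of $\begin{pmatrix}a_{\ell-1}&1\\1&0\end{pmatrix}\cdots\begin{pmatrix}a_{\ell-i}&1\\1&0\end{pmatrix}$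 (so $v_0=(1,0)$). Let $$\sigma=\sigma(\mathfrak b^{-1})=\sigma\big((0,1),(\alpha_{\ell-1},\beta_{\ell-1})\big),\qquad \tau=\sigma\big((0,-1),(\alpha_{\ell-1},\beta_{\ell-1})\big),$$ and for $-1\le i\le \ell-1$ $$M_i=(-1)^{i+1}\big((\beta_i\alpha_{\ell-1}-\alpha_i\beta_{\ell-1})x_2+\alpha_ix_1\big).$$ Note that $\check\sigma=\sigma((1,0),(-\beta_{\ell-1},\alpha_{\ell-1}))$. **Proposition.** 1. $\sigma$ and $\check\sigma$ are lattice cones, $\check\sigma$ is similar to $\tau$, and with $\sigma_0'=\sigma(-v_{-1},v_0)$ and $\sigma_i=\sigma(v_{i-1},v_i)$ for $1\le i\le\ell-1$ (all nonsingular) one has the virtual decomposition $\tau=\sigma_0'+\sigma_1+\dots+\sigma_{\ell-1}$, and $$S_{\check\sigma}(x_1,x_2)=F\big(A_{\sigma_0'}^{-1}A_\tau(x_1,x_2)^t\big)+\sum_{i=1}^{\ell-1}(-1)^{i-1}F\big(A_{\sigma_i}^{-1}A_\tau(x_1,x_2)^t\big).$$ 2. $$\mathrm{Todd}_{\check\sigma}(x_1,x_2)=\alpha_{\ell-1}x_1x_2\left(\sum_{i=-1}^{\ell-2}(-1)^iF(M_i,M_{i+1})+\frac1{1-e^{-\alpha_{\ell-1}x_2}}\right).$$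 3. For every integer $k\ge0$, with $$L_k(X,Y)=\sum_{i=1}^{2k+1}\frac{B_i}{i!}\frac{B_{2k+2-i}}{(2k+2-i)!}X^{i-1}Y^{2k-i+1},\qquad R_k(X,Y)=X^{2k}+X^{2k-1}Y+\dots+Y^{2k},$$ the homogeneous part of degree $2k+2$ of $\mathrm{Todd}_{\check\sigma}$ is $$\alpha_{\ell-1}\left(\sum_{i=-1}^{\ell-2}(-1)^iL_k(M_{i+1},M_i)\,x_1x_2+\sum_{i=1}^{\ell-1}(-1)^ia_{\ell-i}R_k(M_{i-2},M_i)\,x_1x_2\,\frac{B_{2k+2}}{(2k+2)!}\right)$$ $$+\frac{B_{2k+2}}{(2k+2)!}\left(-x_1M_0^{2k+1}+x_2M_{\ell-2}^{2k+1}\right)+\delta_{k,0}\,\frac12\,\alpha_{\ell-1}x_1x_2 .$$ -/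

import Mathlib

noncomputable section

namespace ConeTodd

open Matrix

/-! ### Oriented cones in the plane and the lattice `ℤ²` -/

/-- The oriented cone `σ(v₁, v₂)`, recorded by its ordered pair of integral generators. -/
@[ext]
structure OrientedCone where
  /-- the first generator -/
  v₁ : Fin 2 → ℤ
  /-- the second generator -/
  v₂ : Fin 2 → ℤ

/-- A lattice vector is primitive if its coordinates are coprime. -/
def IsPrimitive (v : Fin 2 → ℤ) : Prop := IsCoprime (v 0) (v 1)

namespace OrientedCone

/-- `A_σ`, the matrix with columns `v₁, v₂`. -/
def mat (σ : OrientedCone) : Matrix (Fin 2) (Fin 2) ℤ :=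
  !![σ.v₁ 0, σ.v₂ 0; σ.v₁ 1, σ.v₂ 1]

/-- A (nondegenerate) lattice cone: the generators are primitive and linearly independent. -/
def IsLatticeCone (σ : OrientedCone) : Prop :=
  IsPrimitive σ.v₁ ∧ IsPrimitive σ.v₂ ∧ σ.mat.det ≠ 0

/-- A nonsingular lattice cone. -/
def IsNonsingular (σ : OrientedCone) : Prop :=
  σ.IsLatticeCone ∧ (σ.mat.det = 1 ∨ σ.mat.det = -1)

/-- Similarity of cones: `P A_σ = A_τ` for some `P ∈ GL₂(ℤ)`. -/
def Similar (σ τ : OrientedCone) : Prop :=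
  ∃ P : GL (Fin 2) ℤ, (P : Matrix (Fin 2) (Fin 2) ℤ) * σ.mat = τ.mat

/-- The dual cone `{y ≠ 0 | ⟨y, x⟩ ≥ 0 for x ∈ σ}` (see `mem_dual_iff`), oriented as `(u₁, u₂)`
where `uᵢ` is the primitive inward vector normal to `vᵢ`. For `σ((0,1), (α,β))` with `α > 0` this
is `((1,0), (-β,α))`. -/
def dual (σ : OrientedCone) : OrientedCone where
  v₁ := σ.mat.det.sign • ![-(σ.v₁ 1), σ.v₁ 0]
  v₂ := σ.mat.det.sign • ![σ.v₂ 1, -(σ.v₂ 0)]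

/-- `M_σ`, the sublattice of `ℤ²` generated by `v₁, v₂`. -/
def sublattice (σ : OrientedCone) : AddSubgroup (Fin 2 → ℤ) :=
  AddSubgroup.closure {σ.v₁, σ.v₂}

/-- `Γ_σ = ℤ² / M_σ`, a finite group when `σ` is nondegenerate. -/
abbrev Gam (σ : OrientedCone) : Type := (Fin 2 → ℤ) ⧸ σ.sublattice

/-- The rational coordinates of `w` in the basis `v₁, v₂`. -/
def coords (σ : OrientedCone) (w : Fin 2 → ℤ) : Fin 2 → ℚ :=
  (σ.mat.map (Int.cast : ℤ → ℚ))⁻¹ *ᵥ (fun j => (w j : ℚ))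

/-- The character `χ_{σ,i}(g) = exp(2π√-1 aᵢ(g))`, for `g = a₁(g) v₁ + a₂(g) v₂`. -/
def char (σ : OrientedCone) (i : Fin 2) (g : σ.Gam) : ℂ :=
  Complex.exp (2 * Real.pi * Complex.I * ((σ.coords g.out i : ℚ) : ℂ))

end OrientedCone

/-! ### Todd series -/

/-- Power series in `x₁ = X 0` and `x₂ = X 1`. -/
abbrev Ser : Type := MvPowerSeries (Fin 2) ℂ

/-- The field of fractions of the ring of power series in `x₁, x₂`. -/
abbrev Mer : Type := FractionRing Ser

/-- `1 - lam * exp(-S)`. -/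
def toddDenom (lam : ℂ) : PowerSeries ℂ :=
  1 - PowerSeries.C lam * PowerSeries.evalNegHom (PowerSeries.exp ℂ)

/-- The twisted Todd series `S / (1 - lam * exp(-S))`. If `lam ≠ 1` the denominator is invertible;
if `lam = 1` it is `S` times an invertible series. -/
def toddTwist (lam : ℂ) : PowerSeries ℂ :=
  if lam = 1 then (PowerSeries.mk fun n => PowerSeries.coeff (n + 1) (toddDenom 1))⁻¹
  else PowerSeries.X * (toddDenom lam)⁻¹

/-- `Todd_σ(x₁, x₂) = ∑_{g ∈ Γ_σ} Todd^{χ₁(g)}(x₁) Todd^{χ₂(g)}(x₂)`. -/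
def todd (σ : OrientedCone) : Ser :=
  ∑ᶠ g : σ.Gam,
    (toddTwist (σ.char 0 g)).subst (MvPowerSeries.X 0 : Ser) *
      (toddTwist (σ.char 1 g)).subst (MvPowerSeries.X 1 : Ser)

/-- The normalized Todd series `S_σ = Todd_σ / (det(A_σ) x₁ x₂)`. -/
def normTodd (σ : OrientedCone) : Mer :=
  algebraMap Ser Mer (todd σ) /
    algebraMap Ser Mer ((σ.mat.det : Ser) * MvPowerSeries.X 0 * MvPowerSeries.X 1)

/-- `F(Y₁, Y₂) = 1 / ((1 - exp(-Y₁)) (1 - exp(-Y₂)))` for series `Y₁, Y₂` without constant term. -/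
def toddF (Y₁ Y₂ : Ser) : Mer :=
  1 / algebraMap Ser Mer (1 - (PowerSeries.exp ℂ).subst (-Y₁)) *
    (1 / algebraMap Ser Mer (1 - (PowerSeries.exp ℂ).subst (-Y₂)))

/-- The pair of linear forms `A_ρ⁻¹ A_τ (x₁, x₂)ᵗ`. -/
def changeCoords (ρ τ : OrientedCone) : Fin 2 → Ser :=
  (((ρ.mat.map (Int.cast : ℤ → ℂ))⁻¹ * τ.mat.map (Int.cast : ℤ → ℂ)).map
    (MvPowerSeries.C : ℂ →+* Ser)) *ᵥ MvPowerSeries.X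

/-- The formal (virtual) decomposition `τ = ρ 0 + ρ 1 + ⋯ + ρ (n-1)` of oriented cones: there are
pairwise linearly independent primitive vectors `v 0, …, v n` in a closed half plane with
`ρ i = σ(v i, v (i+1))` and `τ = σ(v 0, v n)`. -/
def IsVirtualSum (τ : OrientedCone) {n : ℕ} (ρ : Fin n → OrientedCone) : Prop :=
  ∃ v : Fin (n + 1) → (Fin 2 → ℤ),
    (∀ i, IsPrimitive (v i)) ∧
    (∀ i j, i ≠ j → v i 0 * v j 1 - v j 0 * v i 1 ≠ 0) ∧
    (∃ u : Fin 2 → ℝ, u ≠ 0 ∧ ∀ i, 0 ≤ u 0 * (v i 0 : ℝ) + u 1 * (v i 1 : ℝ)) ∧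
    (∀ i : Fin n, ρ i = ⟨v i.castSucc, v i.succ⟩) ∧
    τ = ⟨v 0, v (Fin.last n)⟩

/-! ### Continued fractions and convergent vectors -/

/-- `x = [[a 0, a 1, …, a (r-1)]]`: the regular continued fraction of `x` is infinite with partial
quotients `a 0, a 1, …`, and this sequence is purely periodic with smallest period `r`. -/
def IsPurelyPeriodicCF (x : ℝ) (a : ℕ → ℕ) (r : ℕ) : Prop :=
  (GenContFract.of x).h = (a 0 : ℝ) ∧
  (∀ n, (GenContFract.of x).partDens.get? n = some (a (n + 1) : ℝ)) ∧
  IsLeast {m : ℕ | 0 < m ∧ ∀ i, a (i + m) = a i} r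

/-- The product `∏_{j=1}^{i} (a_{ℓ-j}, 1; 1, 0)`, from left to right. -/
def convMat (a : ℕ → ℕ) (ℓ : ℕ) : ℕ → Matrix (Fin 2) (Fin 2) ℤ
  | 0 => 1
  | i + 1 => convMat a ℓ i * !![(a (ℓ - (i + 1)) : ℤ), 1; 1, 0]

/-- The convergent vectors `v_i = (α_i, β_i)`, `i ≥ -1`: `v_{-1} = (0, 1)`, and `v_i` is the first
column of the product above for `i ≥ 0` (so `v_0 = (1, 0)`). -/
def convVec (a : ℕ → ℕ) (ℓ : ℕ) (i : ℤ) : Fin 2 → ℤ :=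
  if i = -1 then ![0, 1] else fun j => convMat a ℓ i.toNat j 0

/-- `α_i` -/
def cfα (a : ℕ → ℕ) (ℓ : ℕ) (i : ℤ) : ℤ := convVec a ℓ i 0

/-- `β_i` -/
def cfβ (a : ℕ → ℕ) (ℓ : ℕ) (i : ℤ) : ℤ := convVec a ℓ i 1

/-- `σ = σ((0,1), (α_{ℓ-1}, β_{ℓ-1}))`. -/
def idealCone (a : ℕ → ℕ) (ℓ : ℕ) : OrientedCone := ⟨![0, 1], convVec a ℓ ((ℓ : ℤ) - 1)⟩

/-- `τ = τ((0,-1), (α_{ℓ-1}, β_{ℓ-1}))`. -/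
def tauCone (a : ℕ → ℕ) (ℓ : ℕ) : OrientedCone := ⟨![0, -1], convVec a ℓ ((ℓ : ℤ) - 1)⟩

/-- The pieces of the decomposition: `σ_0' = σ(-v_{-1}, v_0)` for index `0`, and
`σ_i = σ(v_{i-1}, v_i)` for `i ≥ 1`. -/
def piece (a : ℕ → ℕ) (ℓ : ℕ) (i : ℕ) : OrientedCone :=
  if i = 0 then ⟨-convVec a ℓ (-1), convVec a ℓ 0⟩
  else ⟨convVec a ℓ ((i : ℤ) - 1), convVec a ℓ i⟩

/-- `M_i = (-1)^{i+1} ((β_i α_{ℓ-1} - α_i β_{ℓ-1}) x₂ + α_i x₁)`. -/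
def cfM (a : ℕ → ℕ) (ℓ : ℕ) (i : ℤ) : Ser :=
  ((-1 : ℂ) ^ (i + 1)) •
    (((cfβ a ℓ i * cfα a ℓ (ℓ - 1) - cfα a ℓ i * cfβ a ℓ (ℓ - 1) : ℤ) : Ser) * MvPowerSeries.X 1 +
      ((cfα a ℓ i : ℤ) : Ser) * MvPowerSeries.X 0)

/-- `B_n / n!` (the choice of sign of `B_1` does not matter below). -/
def bern (n : ℕ) : ℂ := ((bernoulli n / (n.factorial : ℚ) : ℚ) : ℂ)

/-- `L_k(X, Y) = ∑_{i=1}^{2k+1} B_i/i! B_{2k+2-i}/(2k+2-i)! X^{i-1} Y^{2k-i+1}`. -/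
def polyL (k : ℕ) (X Y : Ser) : Ser :=
  ∑ i ∈ Finset.Icc 1 (2 * k + 1),
    (bern i * bern (2 * k + 2 - i)) • (X ^ (i - 1) * Y ^ (2 * k + 1 - i))

/-- `R_k(X, Y) = X^{2k} + X^{2k-1} Y + ⋯ + Y^{2k}`. -/
def polyR (k : ℕ) (X Y : Ser) : Ser :=
  ∑ j ∈ Finset.range (2 * k + 1), X ^ (2 * k - j) * Y ^ j

/-! ### Checks of the definitions -/

/-- The defining property `toddTwist lam = S / (1 - lam * exp(-S))`. -/
theorem toddTwist_mul_toddDenom (lam : ℂ) : toddTwist lam * toddDenom lam = PowerSeries.X := by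
  have h0 : PowerSeries.constantCoeff (toddDenom lam) = 1 - lam := by
    have h : PowerSeries.constantCoeff (PowerSeries.evalNegHom (PowerSeries.exp ℂ)) = 1 := by
      rw [← PowerSeries.coeff_zero_eq_constantCoeff_apply, PowerSeries.evalNegHom,
        PowerSeries.coeff_rescale, PowerSeries.coeff_exp]
      simp
    simp [toddDenom, h]
  by_cases h : lam = 1
  · subst h
    set E : PowerSeries ℂ := PowerSeries.mk fun n => PowerSeries.coeff (n + 1) (toddDenom 1) with hE
    have hD : toddDenom 1 = E * PowerSeries.X := by
      ext n
      cases n with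
      | zero => simpa using h0
      | succ n => simp [hE, PowerSeries.coeff_succ_mul_X]
    have h1 : PowerSeries.constantCoeff E ≠ 0 := by
      simp [hE, toddDenom, PowerSeries.evalNegHom, PowerSeries.coeff_rescale,
        PowerSeries.coeff_one]
    rw [toddTwist, if_pos rfl, ← hE, hD, ← mul_assoc, PowerSeries.inv_mul_cancel _ h1, one_mul]
  · have h1 : PowerSeries.constantCoeff (toddDenom lam) ≠ 0 := by
      rw [h0]; exact sub_ne_zero.mpr (Ne.symm h)
    rw [toddTwist, if_neg h, mul_assoc, PowerSeries.inv_mul_cancel _ h1, mul_one]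

namespace OrientedCone

/-- The characters do not depend on representatives. -/
theorem char_mk (σ : OrientedCone) (hσ : σ.mat.det ≠ 0) (i : Fin 2) (w : Fin 2 → ℤ) :
    σ.char i (QuotientAddGroup.mk w) =
      Complex.exp (2 * Real.pi * Complex.I * ((σ.coords w i : ℚ) : ℂ)) := by
  obtain ⟨m, hm⟩ := QuotientAddGroup.mk_out_eq_add σ.sublattice w
  obtain ⟨p, q, hpq⟩ := AddSubgroup.mem_closure_pair.mp m.2
  have hdet : IsUnit (σ.mat.map (Int.cast : ℤ → ℚ)).det := by
    have h : (σ.mat.map (Int.cast : ℤ → ℚ)).det = (σ.mat.det : ℚ) := by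
      simp [Matrix.det_fin_two]
    rw [h]
    exact isUnit_iff_ne_zero.mpr (by exact_mod_cast hσ)
  have hc : σ.coords (w + m) = σ.coords w + ![(p : ℚ), (q : ℚ)] := by
    have h2 : (fun j => (((w + (m : Fin 2 → ℤ)) j : ℤ) : ℚ)) =
        (fun j => ((w j : ℤ) : ℚ)) + (σ.mat.map (Int.cast : ℤ → ℚ)) *ᵥ ![(p : ℚ), (q : ℚ)] := by
      funext j
      rw [← hpq]
      fin_cases j <;> simp [mat] <;> ring
    rw [coords, coords, h2, Matrix.mulVec_add, Matrix.mulVec_mulVec,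
      Matrix.nonsing_inv_mul _ hdet, Matrix.one_mulVec]
  have hk : ∃ n : ℤ, σ.coords (w + m) i = σ.coords w i + n := by
    rw [hc]
    fin_cases i
    · exact ⟨p, by simp⟩
    · exact ⟨q, by simp⟩
  obtain ⟨n, hn⟩ := hk
  rw [char, hm, hn]
  push_cast
  rw [mul_add, Complex.exp_add]
  have h1 : Complex.exp (2 * Real.pi * Complex.I * (n : ℂ)) = 1 := by
    rw [mul_comm]; exact Complex.exp_int_mul_two_pi_mul_I n
  rw [h1, mul_one]

/-- The cone generated by `dual σ` is the dual cone: `⟨y, v₁⟩, ⟨y, v₂⟩ ≥ 0` if and only if `y` is a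
nonnegative combination of the generators of `dual σ`. -/
theorem mem_dual_iff (σ : OrientedCone) (hσ : σ.mat.det ≠ 0) (y : Fin 2 → ℝ) :
    (0 ≤ y 0 * σ.v₁ 0 + y 1 * σ.v₁ 1 ∧ 0 ≤ y 0 * σ.v₂ 0 + y 1 * σ.v₂ 1) ↔
      ∃ c₁ c₂ : ℝ, 0 ≤ c₁ ∧ 0 ≤ c₂ ∧
        ∀ j, y j = c₁ * (σ.dual.v₁ j : ℝ) + c₂ * (σ.dual.v₂ j : ℝ) := by
  have hd : σ.mat.det = σ.v₁ 0 * σ.v₂ 1 - σ.v₂ 0 * σ.v₁ 1 := by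
    simp [mat, Matrix.det_fin_two]
  set D : ℝ := (σ.v₁ 0 : ℝ) * σ.v₂ 1 - σ.v₂ 0 * σ.v₁ 1 with hD
  have hdD : ((σ.mat.det : ℤ) : ℝ) = D := by rw [hd, hD]; push_cast; ring
  obtain ⟨s, hs, hs2, hsD⟩ : ∃ s : ℝ, ((σ.mat.det.sign : ℤ) : ℝ) = s ∧ s * s = 1 ∧ 0 < s * D := by
    refine ⟨_, rfl, ?_, ?_⟩
    · rcases lt_or_gt_of_ne hσ with h | h
      · rw [Int.sign_eq_neg_one_of_neg h]; norm_num
      · rw [Int.sign_eq_one_of_pos h]; norm_num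
    · rw [← hdD, ← Int.cast_mul, Int.sign_mul_self_eq_abs]
      exact_mod_cast abs_pos.mpr hσ
  have hDne : D ≠ 0 := by rintro h; simp [h] at hsD
  constructor
  · rintro ⟨h1, h2⟩
    refine ⟨(y 0 * σ.v₂ 0 + y 1 * σ.v₂ 1) / (s * D), (y 0 * σ.v₁ 0 + y 1 * σ.v₁ 1) / (s * D),
      div_nonneg h2 hsD.le, div_nonneg h1 hsD.le, ?_⟩
    have hsne : s ≠ 0 := by rintro h; simp [h] at hs2
    intro j
    fin_cases j <;> simp [dual, hs] <;> field_simp <;> rw [hD] <;> ring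
  · rintro ⟨c₁, c₂, h1, h2, h⟩
    have e0 := h 0
    have e1 := h 1
    simp [dual, hs] at e0 e1
    have k1 : y 0 * σ.v₁ 0 + y 1 * σ.v₁ 1 = c₂ * (s * D) := by rw [e0, e1, hD]; ring
    have k2 : y 0 * σ.v₂ 0 + y 1 * σ.v₂ 1 = c₁ * (s * D) := by rw [e0, e1, hD]; ring
    rw [k1, k2]
    exact ⟨mul_nonneg h2 hsD.le, mul_nonneg h1 hsD.le⟩

end OrientedCone

end ConeTodd

end

open ConeTodd

namespace ConeTodd

/-! ### Convergents as sequences of natural numbers -/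

/-! Put `N = α_{ℓ-1}` and `q = β_{ℓ-1}`. The dual cone is generated by `(1,0)` and `(-q,N)`, its
group is cyclic of order `N`, and its characters are `ζ^(jq)` and `ζ^j`. With `X = exp(-x₁)`, `Y =
exp(-x₂)`, the normalized Todd series is the average over `j` of `1/((1 - ζ^(jq) X)(1 - ζ^j Y))`.
Expanding in geometric sums and using orthogonality of roots of unity (`sum_roots_eq_stair`) leaves
only monomials `X^m Y^(cN - qm)` with `c = ⌈qm/N⌉`, that is `W^m T^c` for `W = X Y^(-q)`, `T = Y^N`.

The resulting quotient `stair / ((1 - T)(1 - W^N T^q))` is the generating function of the lattice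
points of the cone spanned by `(0,1)` and `(N,q)`. Passing from one convergent vector to the next
adds or removes a half-open unimodular cone (`stairRel_convergents`), so the function telescopes to
an alternating sum of products `1/((1 - e)(1 - e'))` with `e = exp(-M_i)` (`stair_div_eq_sum`). This
is the formula for the normalized Todd series; rewriting the initial quadrant through `1/(1 - W) = 1
- 1/(1 - W⁻¹)` gives the formula in the `M_i`.

For the graded statement, each summand is a quotient with a homogeneous denominator, and
`HasComponent` makes sense of its graded pieces. The middle Bernoulli terms form `L_k`. The extreme
ones have linear denominators, which cancel in neighbouring pairs because `M_{i-2} - M_i = a_{ℓ-i}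
M_{i-1}` (`alternating_sum_div`). Only `M_{-1} = N x₂` and, as `ℓ` is even, `M_{ℓ-1} = N x₁` survive
as denominators, and the prefactor `N x₁ x₂` clears them. -/

/-- The first coordinates of the convergent vectors, with index shifted by one. -/
def cfNum (b : ℕ → ℕ) : ℕ → ℕ
  | 0 => 0
  | 1 => 1
  | n + 2 => b n * cfNum b (n + 1) + cfNum b n

/-- The second coordinates of the convergent vectors, with index shifted by one. -/
def cfDen (b : ℕ → ℕ) : ℕ → ℕ
  | 0 => 1
  | 1 => 0
  | n + 2 => b n * cfDen b (n + 1) + cfDen b n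

theorem cfNum_pos {b : ℕ → ℕ} (hb : ∀ n, 0 < b n) : ∀ n, 0 < cfNum b (n + 1)
  | 0 => by simp [cfNum]
  | n + 1 => by
    rw [cfNum]
    have := Nat.mul_pos (hb n) (cfNum_pos hb n)
    omega

theorem cfNum_mul_cfDen_sub (b : ℕ → ℕ) (n : ℕ) :
    (cfNum b n * cfDen b (n + 1) - cfNum b (n + 1) * cfDen b n : ℤ) = (-1) ^ (n + 1) := by
  induction n with
  | zero => simp [cfNum, cfDen]
  | succ n ih =>
    rw [cfNum, cfDen, pow_succ, ← ih]
    push_cast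
    ring

/-- All later convergent vectors lie strictly on one side of the `m`-th: the signed determinant
obeys the convergent recursion with positive coefficients. Two consecutive values are carried
through the induction because the recursion has order two. -/
theorem det_convergents_pos {b : ℕ → ℕ} (hb : ∀ n, 0 < b n) (m k : ℕ) :
    0 < (-1) ^ (m + 1) * (cfNum b m * cfDen b (m + k + 1) - cfNum b (m + k + 1) * cfDen b m : ℤ) ∧
    0 ≤ (-1) ^ (m + 1) * (cfNum b m * cfDen b (m + k) - cfNum b (m + k) * cfDen b m : ℤ) := by
  induction k with
  | zero =>
    refine ⟨?_, by simp [mul_comm]⟩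
    rw [add_zero, cfNum_mul_cfDen_sub, ← mul_pow]
    simp
  | succ k ih =>
    refine ⟨?_, ih.1.le⟩
    have h : (0 : ℤ) < b (m + k) := by exact_mod_cast hb _
    have h1 := mul_pos h ih.1
    rw [show m + (k + 1) + 1 = m + k + 2 by ring, cfNum, cfDen]
    push_cast
    linear_combination h1 + ih.2

theorem det_convergents_ne_zero {b : ℕ → ℕ} (hb : ∀ n, 0 < b n) {m n : ℕ} (h : m ≠ n) :
    (cfNum b m * cfDen b n - cfNum b n * cfDen b m : ℤ) ≠ 0 := by
  wlog hmn : m < n generalizing m n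
  · have := this h.symm (by omega)
    contrapose! this
    linarith
  obtain ⟨k, rfl⟩ := Nat.exists_eq_add_of_lt hmn
  intro h0
  have := (det_convergents_pos hb m k).1
  simp [h0] at this

/-! ### Staircase sums -/

section Staircase

variable {F : Type*} [Field F] (T W : F)

/-- The sum of the monomials `W ^ m * T ^ ⌈q m / N⌉` for `0 ≤ m < N`. -/
def stair (N q : ℕ) : F :=
  ∑ m ∈ Finset.range N, W ^ m * T ^ ((q * m + N - 1) / N)

theorem ceil_eq {N q m c : ℕ} (h1 : q * m ≤ c * N) (h2 : c * N < q * m + N) :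
    (q * m + N - 1) / N = c := by
  have hN : 0 < N := by
    rcases Nat.eq_zero_or_pos N with rfl | h
    · simp at h1 h2; omega
    · exact h
  rw [Nat.div_eq_iff hN]
  omega

theorem ceil_spec {N : ℕ} (hN : 0 < N) (q m : ℕ) :
    q * m ≤ (q * m + N - 1) / N * N ∧ (q * m + N - 1) / N * N < q * m + N := by
  have h1 := Nat.div_add_mod (q * m + N - 1) N
  have h2 := Nat.mod_lt (q * m + N - 1) hN
  rw [mul_comm] at h1
  omega

/-- The parallelogram on a unimodular pair has no interior lattice points, so the staircase above
the diagonal `(N + N', q + q')` follows that of `(N', q')` and then a translate of that of `(N, q)`.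
-/
theorem stair_add {N q N' q' : ℕ} (hN : 0 < N) (hN' : 0 < N') (hdet : N * q' = q * N' + 1) :
    stair T W (N + N') (q + q') = stair T W N' q' + W ^ N' * T ^ q' * stair T W N q := by
  rw [stair, add_comm N N', Finset.sum_range_add, stair, stair, Finset.mul_sum]
  congr 1
  · refine Finset.sum_congr rfl fun m hm => ?_
    rw [Finset.mem_range] at hm
    congr 2
    obtain ⟨h1, h2⟩ := ceil_spec hN' q' m
    generalize (q' * m + N' - 1) / N' = c at *
    apply ceil_eq
    -- After multiplication by `N'` the determinant relation replaces `q N'` by `N q' - 1`; the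
    -- error `m` is too small to change the ceiling.
    · refine Nat.le_of_mul_le_mul_left ?_ hN'
      zify at *
      nlinarith
    · refine Nat.lt_of_mul_lt_mul_left (a := N') ?_
      zify at *
      nlinarith
  · refine Finset.sum_congr rfl fun m hm => ?_
    rw [Finset.mem_range] at hm
    obtain ⟨h1, h2⟩ := ceil_spec hN q m
    rw [show ((q + q') * (N' + m) + (N' + N) - 1) / (N' + N) = q' + (q * m + N - 1) / N from ?_]
    · ring
    generalize (q * m + N - 1) / N = c at *
    apply ceil_eq
    · refine Nat.le_of_mul_le_mul_left ?_ hN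
      zify at *
      nlinarith
    · refine Nat.lt_of_mul_lt_mul_left (a := N) ?_
      zify at *
      nlinarith

/-- The relation between the staircase sums of two vectors of determinant one. -/
def StairRel (N q N' q' : ℕ) : Prop :=
  stair T W N' q' * (1 - W ^ N * T ^ q) - stair T W N q * (1 - W ^ N' * T ^ q') =
    -((1 - T) * (W ^ N * T ^ q))

variable {T W}

/-- Substituting `stair_add` turns the new relation into the old one multiplied by `W^N' T^q'`; in
`StairRel.add_right` it becomes the old one unchanged. -/
theorem StairRel.add_left {N q N' q' : ℕ} (hN : 0 < N) (hN' : 0 < N') (hdet : N * q' = q * N' + 1)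
    (h : StairRel T W N q N' q') (k : ℕ) : StairRel T W (k * N' + N) (k * q' + q) N' q' := by
  induction k with
  | zero => simpa using h
  | succ k ih =>
    have e := stair_add T W (N := k * N' + N) (q := k * q' + q) (q' := q') (by omega) hN'
      (by linear_combination hdet)
    rw [show (k + 1) * N' + N = k * N' + N + N' by ring,
      show (k + 1) * q' + q = k * q' + q + q' by ring]
    unfold StairRel at *
    rw [e]
    simp only [pow_add] at *
    linear_combination W ^ N' * T ^ q' * ih

theorem StairRel.add_right {N q N' q' : ℕ} (hN : 0 < N) (hN' : 0 < N') (hdet : N * q' = q * N' + 1)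
    (h : StairRel T W N q N' q') (k : ℕ) : StairRel T W N q (k * N + N') (k * q + q') := by
  induction k with
  | zero => simpa using h
  | succ k ih =>
    have e := stair_add T W (q := q) (N' := k * N + N') (q' := k * q + q') hN (by omega)
      (by linear_combination hdet)
    rw [show (k + 1) * N + N' = N + (k * N + N') by ring,
      show (k + 1) * q + q' = q + (k * q + q') by ring]
    unfold StairRel at *
    rw [e]
    simp only [pow_add] at *
    linear_combination ih

/-- The determinant of consecutive convergents alternates in sign, so the two vectors exchange roles
at each step; the new vector is obtained by adding a multiple of the last one to the one before. -/
theorem stairRel_convergents {b : ℕ → ℕ} (hb : ∀ n, 0 < b n) (n : ℕ) :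
    if Even n then StairRel T W (cfNum b (n + 1)) (cfDen b (n + 1)) (cfNum b (n + 2)) (cfDen b (n + 2))
    else StairRel T W (cfNum b (n + 2)) (cfDen b (n + 2)) (cfNum b (n + 1)) (cfDen b (n + 1)) := by
  induction n with
  | zero =>
    -- The induction starts from `(1,0), (1,1)`, since `(0,1)` has an empty staircase; adding
    -- `(1,0)` another `b 0 - 1` times reaches `(b 0, 1)`.
    have h : StairRel T W 1 0 1 1 := by
      simp [StairRel, stair]
      ring
    have h2 := h.add_right one_pos one_pos rfl (b 0 - 1)
    have hb0 := hb 0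
    simp only [Even.zero, if_true, cfNum, cfDen]
    convert h2 using 1
    · omega
    · simp
  | succ n ih =>
    have hdet := cfNum_mul_cfDen_sub b (n + 1)
    have p1 := cfNum_pos hb n
    have p2 := cfNum_pos hb (n + 1)
    by_cases hn : Even n
    · rw [if_pos hn] at ih
      have hn' : ¬ Even (n + 1) := by simpa [Nat.even_add_one] using hn
      rw [if_neg hn']
      rw [(hn.add_one.add_one : Even (n + 1 + 1)).neg_one_pow] at hdet
      refine ih.add_left p1 p2 ?_ (b (n + 1))
      zify
      linear_combination hdet
    · rw [if_neg hn] at ih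
      have hn' : Even (n + 1) := by simpa [Nat.even_add_one] using hn
      rw [if_pos hn']
      rw [hn'.add_one.neg_one_pow] at hdet
      refine ih.add_right p2 p1 ?_ (b (n + 1))
      zify
      linear_combination -hdet

/-- A normalized staircase sum as an alternating sum over the convergents. -/
theorem stair_div_eq_sum {b : ℕ → ℕ} (hb : ∀ n, 0 < b n) (hT : T ≠ 0) (hW : W ≠ 0)
    (h1 : ∀ n, W ^ cfNum b n * T ^ cfDen b n ≠ 1) (e : ℕ → F)
    (he : ∀ n, e n = if Even n then W ^ cfNum b n * T ^ cfDen b n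
      else (W ^ cfNum b n * T ^ cfDen b n)⁻¹) (n : ℕ) :
    stair T W (cfNum b (n + 1)) (cfDen b (n + 1)) /
        ((1 - T) * (1 - W ^ cfNum b (n + 1) * T ^ cfDen b (n + 1))) =
      1 / (1 - W) * (1 / (1 - T)) + ∑ i ∈ Finset.Icc 1 n, (-1) ^ (i - 1) *
        (1 / (1 - e (i + 1)) * (1 / (1 - e i))) := by
  have hT1 : 1 - T ≠ 0 := by
    have := h1 0
    simp only [cfNum, cfDen, pow_zero, one_mul, pow_one] at this
    exact sub_ne_zero.mpr this.symm
  have hW1 : 1 - W ≠ 0 := by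
    have := h1 1
    simp only [cfNum, cfDen, pow_zero, mul_one, pow_one] at this
    exact sub_ne_zero.mpr this.symm
  induction n with
  | zero =>
    simp [cfNum, cfDen, stair]
  | succ n ih =>
    rw [Finset.sum_Icc_succ_top (by omega), ← add_assoc, ← ih, he, he, Nat.add_sub_cancel]
    -- Divided by `(1 - T)(1 - z)(1 - z')`, this says that two successive cones differ by a
    -- half-open unimodular cone. Inverting the monomial of odd index absorbs the numerator, by
    -- `1/(1 - z⁻¹) = -z/(1 - z)`.
    have hr := stairRel_convergents (T := T) (W := W) hb n
    have hz : W ^ cfNum b (n + 1) * T ^ cfDen b (n + 1) ≠ 0 :=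
      mul_ne_zero (pow_ne_zero _ hW) (pow_ne_zero _ hT)
    have hz' : W ^ cfNum b (n + 2) * T ^ cfDen b (n + 2) ≠ 0 :=
      mul_ne_zero (pow_ne_zero _ hW) (pow_ne_zero _ hT)
    have g := sub_ne_zero.mpr (h1 (n + 1)).symm
    have g' := sub_ne_zero.mpr (h1 (n + 2)).symm
    unfold StairRel at hr
    rw [show n + 1 + 1 = n + 2 by ring]
    generalize stair T W (cfNum b (n + 1)) (cfDen b (n + 1)) = P at *
    generalize stair T W (cfNum b (n + 2)) (cfDen b (n + 2)) = P' at *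
    generalize W ^ cfNum b (n + 1) * T ^ cfDen b (n + 1) = z at *
    generalize W ^ cfNum b (n + 2) * T ^ cfDen b (n + 2) = z' at *
    have gi : 1 - z⁻¹ ≠ 0 := by
      rw [sub_ne_zero]; contrapose! g; rw [sub_eq_zero, eq_comm, ← inv_eq_one]; exact g.symm
    have gi' : 1 - z'⁻¹ ≠ 0 := by
      rw [sub_ne_zero]; contrapose! g'; rw [sub_eq_zero, eq_comm, ← inv_eq_one]; exact g'.symm
    have ei : 1 / (1 - z⁻¹) = - z / (1 - z) := by
      rw [div_eq_div_iff gi g]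
      linear_combination -mul_inv_cancel₀ hz
    have ei' : 1 / (1 - z'⁻¹) = - z' / (1 - z') := by
      rw [div_eq_div_iff gi' g']
      linear_combination -mul_inv_cancel₀ hz'
    by_cases hn : Even n
    · rw [if_pos hn] at hr
      have hn1 : ¬ Even (n + 1) := by simpa [Nat.even_add_one] using hn
      have hn2 : Even (n + 2) := by simpa [Nat.even_add] using hn
      rw [if_neg hn1, if_pos hn2, hn.neg_one_pow, ei]
      field_simp
      linear_combination hr
    · rw [if_neg hn] at hr
      have hn1 : Even (n + 1) := by simpa [Nat.even_add_one] using hn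
      have hn2 : ¬ Even (n + 2) := by simpa [Nat.even_add] using hn
      rw [if_pos hn1, if_neg hn2, (Nat.not_even_iff_odd.mp hn).neg_one_pow, ei']
      field_simp
      linear_combination -hr

end Staircase

/-! ### Exponentials of power series without constant term -/

theorem exp_subst_X_add_X :
    (PowerSeries.exp ℂ).subst (MvPowerSeries.X 0 + MvPowerSeries.X 1 : Ser) =
      (PowerSeries.exp ℂ).subst (MvPowerSeries.X 0 : Ser) *
        (PowerSeries.exp ℂ).subst (MvPowerSeries.X 1 : Ser) := by
  ext e
  rw [PowerSeries.coeff_subst_X_zero_add_X_one, PowerSeries.coeff_subst_X_zero_subst_mul_X_one]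
  simp only [PowerSeries.coeff_exp, eq_ratCast, one_div]
  rw [Nat.choose_symm_add, Nat.add_choose]
  rw [Nat.cast_div (Nat.factorial_mul_factorial_dvd_factorial_add _ _)
    (Nat.cast_ne_zero.mpr (by positivity))]
  have h := Nat.factorial_ne_zero (e 0 + e 1)
  push_cast
  field_simp

theorem hasSubst_of_zero {a : Ser} (ha : MvPowerSeries.constantCoeff a = 0) :
    PowerSeries.HasSubst a := PowerSeries.HasSubst.of_constantCoeff_zero ha

/-- Substitute `a, b` for the variables in the universal identity `exp_subst_X_add_X`. -/
theorem exp_subst_add {a b : Ser} (ha : MvPowerSeries.constantCoeff a = 0)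
    (hb : MvPowerSeries.constantCoeff b = 0) :
    (PowerSeries.exp ℂ).subst (a + b) =
      (PowerSeries.exp ℂ).subst a * (PowerSeries.exp ℂ).subst b := by
  have hab : MvPowerSeries.HasSubst (![a, b] : Fin 2 → Ser) := by
    apply MvPowerSeries.hasSubst_of_constantCoeff_zero
    intro i
    fin_cases i <;> simp [ha, hb]
  have key : ∀ c : Ser, MvPowerSeries.constantCoeff c = 0 →
      MvPowerSeries.subst (![a, b] : Fin 2 → Ser) ((PowerSeries.exp ℂ).subst c) =
        (PowerSeries.exp ℂ).subst (MvPowerSeries.subst (![a, b] : Fin 2 → Ser) c) := fun c hc => by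
    rw [PowerSeries.subst, PowerSeries.subst,
      MvPowerSeries.subst_comp_subst_apply (hasSubst_of_zero hc).const hab]
  have h := congrArg (MvPowerSeries.subst (![a, b] : Fin 2 → Ser)) exp_subst_X_add_X
  rw [MvPowerSeries.subst_mul hab, key _ (by simp), key _ (by simp), key _ (by simp),
    MvPowerSeries.subst_add hab, MvPowerSeries.subst_X hab, MvPowerSeries.subst_X hab] at h
  simpa using h

/-- The exponential `exp(-a)` in the field of fractions. -/
noncomputable def expMer (a : Ser) : Mer := algebraMap Ser Mer ((PowerSeries.exp ℂ).subst (-a))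

theorem expMer_add {a b : Ser} (ha : MvPowerSeries.constantCoeff a = 0)
    (hb : MvPowerSeries.constantCoeff b = 0) : expMer (a + b) = expMer a * expMer b := by
  rw [expMer, neg_add, exp_subst_add (by simp [ha]) (by simp [hb]), map_mul]
  rfl

theorem expMer_zero : expMer 0 = 1 := by
  rw [expMer, neg_zero, PowerSeries.subst_zero_eq_C_constantCoeff]
  simp

theorem expMer_mul_neg {a : Ser} (ha : MvPowerSeries.constantCoeff a = 0) :
    expMer a * expMer (-a) = 1 := by
  rw [← expMer_add ha (by simp [ha]), add_neg_cancel, expMer_zero]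

theorem expMer_ne_zero {a : Ser} (ha : MvPowerSeries.constantCoeff a = 0) : expMer a ≠ 0 :=
  left_ne_zero_of_mul_eq_one (expMer_mul_neg ha)

theorem expMer_neg {a : Ser} (ha : MvPowerSeries.constantCoeff a = 0) :
    expMer (-a) = (expMer a)⁻¹ :=
  eq_inv_of_mul_eq_one_right (expMer_mul_neg ha)

theorem expMer_natCast_mul {a : Ser} (ha : MvPowerSeries.constantCoeff a = 0) (n : ℕ) :
    expMer ((n : Ser) * a) = expMer a ^ n := by
  induction n with
  | zero => simp [expMer_zero]
  | succ n ih =>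
    rw [Nat.cast_add, add_mul, expMer_add (by simp [ha]) (by simp [ha]), ih, pow_succ]
    simp

theorem toddDenom_subst {a : Ser} (ha : MvPowerSeries.constantCoeff a = 0) (lam : ℂ) :
    (toddDenom lam).subst a =
      1 - MvPowerSeries.C lam * (PowerSeries.exp ℂ).subst (-a) := by
  have h := hasSubst_of_zero ha
  rw [toddDenom, PowerSeries.subst_sub h, PowerSeries.subst_mul h, PowerSeries.subst_C,
    ← PowerSeries.coe_substAlgHom h, map_one, PowerSeries.coe_substAlgHom, PowerSeries.evalNegHom,
    PowerSeries.rescale_eq_subst,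
    PowerSeries.subst_comp_subst_apply (PowerSeries.HasSubst.smul_X' _) h,
    PowerSeries.subst_smul h, PowerSeries.subst_X h]
  simp

theorem toddTwist_subst_mul {a : Ser} (ha : MvPowerSeries.constantCoeff a = 0) (lam : ℂ) :
    algebraMap Ser Mer ((toddTwist lam).subst a) *
      (1 - algebraMap Ser Mer (MvPowerSeries.C lam) * expMer a) = algebraMap Ser Mer a := by
  have h := hasSubst_of_zero ha
  have e := congrArg (PowerSeries.subst a) (toddTwist_mul_toddDenom lam)
  rw [PowerSeries.subst_mul h, toddDenom_subst ha, PowerSeries.subst_X h] at e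
  have e2 := congrArg (algebraMap Ser Mer) e
  simpa only [map_mul, map_sub, map_one, expMer] using e2

theorem algebraMap_ne_zero {a : Ser} (ha : a ≠ 0) : algebraMap Ser Mer a ≠ 0 := by
  rw [Ne, FaithfulSMul.algebraMap_eq_zero_iff]
  exact ha

/-- Substituting `a` in `Todd(S)(1 - exp(-S)) = S` shows that `exp(-a) = 1` would force `a = 0`. -/
theorem expMer_ne_one {a : Ser} (ha : MvPowerSeries.constantCoeff a = 0) (h0 : a ≠ 0) :
    expMer a ≠ 1 := by
  intro h
  have e := toddTwist_subst_mul ha 1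
  rw [h, map_one, map_one, mul_one, sub_self, mul_zero] at e
  exact algebraMap_ne_zero h0 e.symm

theorem toddF_eq (a b : Ser) :
    toddF a b = 1 / (1 - expMer a) * (1 / (1 - expMer b)) := by
  simp [toddF, expMer]

theorem toddF_comm (a b : Ser) : toddF a b = toddF b a := by
  rw [toddF, toddF, mul_comm]

/-! ### Sums over roots of unity -/

section RootsOfUnity

variable {F : Type*} [Field F]

theorem one_div_one_sub_mul {ζ X : F} {N : ℕ} (hζ : ζ ^ N = 1) (hX : X ^ N ≠ 1) :
    1 / (1 - ζ * X) = (∑ m ∈ Finset.range N, ζ ^ m * X ^ m) / (1 - X ^ N) := by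
  have h1 : (1 - ζ * X) * ∑ m ∈ Finset.range N, ζ ^ m * X ^ m = 1 - X ^ N := by
    simp_rw [← mul_pow]
    rw [mul_neg_geom_sum, mul_pow, hζ, one_mul]
  have h2 : 1 - X ^ N ≠ 0 := sub_ne_zero.mpr hX.symm
  have h3 : 1 - ζ * X ≠ 0 := by
    intro h
    rw [h, zero_mul] at h1
    exact h2 h1.symm
  rw [div_eq_div_iff h3 h2, one_mul, mul_comm, h1]

theorem sum_pow_primitiveRoot {ζ : F} {N : ℕ} (hζ : IsPrimitiveRoot ζ N) (k : ℕ) :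
    ∑ j ∈ Finset.range N, (ζ ^ j) ^ k = if N ∣ k then (N : F) else 0 := by
  simp_rw [← pow_mul, mul_comm _ k, pow_mul]
  split_ifs with h
  · rw [(hζ.pow_eq_one_iff_dvd k).mpr h]
    simp
  · have h1 : ζ ^ k - 1 ≠ 0 := by
      rwa [sub_ne_zero, Ne, hζ.pow_eq_one_iff_dvd k]
    have h2 := mul_geom_sum (ζ ^ k) N
    rw [← pow_mul, mul_comm k, pow_mul, hζ.pow_eq_one, one_pow, sub_self] at h2
    exact (mul_eq_zero.mp h2).resolve_left h1

/-- Both factors become finite geometric sums over `1 - X^N` and `1 - Y^N`. The sum over `j` keeps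
the pairs `(m, n)` with `N ∣ qm + n`. -/
theorem sum_roots_eq_stair {ζ X Y : F} {N : ℕ} (hN : 0 < N) (hζ : IsPrimitiveRoot ζ N) (q : ℕ)
    (hX : X ^ N ≠ 1) (hY : Y ^ N ≠ 1) (hY0 : Y ≠ 0) :
    ∑ j ∈ Finset.range N, 1 / (1 - (ζ ^ j) ^ q * X) * (1 / (1 - ζ ^ j * Y)) =
      N * (stair (Y ^ N) (X * (Y ^ q)⁻¹) N q / ((1 - Y ^ N) * (1 - X ^ N))) := by
  have h1 : ∀ j, (ζ ^ j) ^ N = 1 := fun j => by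
    rw [← pow_mul, mul_comm, pow_mul, hζ.pow_eq_one, one_pow]
  have h2 : ∀ j, ((ζ ^ j) ^ q) ^ N = 1 := fun j => by
    rw [← pow_mul, mul_comm, pow_mul, h1, one_pow]
  simp_rw [one_div_one_sub_mul (h1 _) hY, one_div_one_sub_mul (h2 _) hX, div_mul_div_comm]
  rw [← Finset.sum_div, mul_comm (1 - X ^ N), ← mul_div_assoc]
  congr 1
  simp_rw [Finset.sum_mul_sum]
  rw [Finset.sum_comm, stair, Finset.mul_sum]
  refine Finset.sum_congr rfl fun m _ => ?_
  rw [Finset.sum_comm]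
  have h3 : ∀ n, ∑ j ∈ Finset.range N, ((ζ ^ j) ^ q) ^ m * X ^ m * ((ζ ^ j) ^ n * Y ^ n) =
      if N ∣ q * m + n then N * (X ^ m * Y ^ n) else 0 := fun n => by
    have e := sum_pow_primitiveRoot hζ (q * m + n)
    rw [← zero_mul (X ^ m * Y ^ n), ← ite_mul, ← e, Finset.sum_mul]
    refine Finset.sum_congr rfl fun j _ => ?_
    rw [pow_add, pow_mul]
    ring
  simp_rw [h3]
  obtain ⟨c1, c2⟩ := ceil_spec hN q m
  generalize (q * m + N - 1) / N = c at *
  -- The unique residue `n < N` with `N ∣ qm + n` is the distance from `qm` up to the next multiple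
  -- `cN`.
  rw [Finset.sum_eq_single_of_mem (c * N - q * m)]
  · rw [if_pos ⟨c, by rw [Nat.add_sub_cancel' c1, mul_comm]⟩, mul_pow, inv_pow, ← pow_mul, ← pow_mul,
      pow_sub₀ _ hY0 c1]
    ring
  · rw [Finset.mem_range]
    omega
  · intro n hn hne
    rw [Finset.mem_range] at hn
    rw [if_neg]
    rintro ⟨d, hd⟩
    apply hne
    have : d = c := by
      have e1 : d < c + 1 := by
        refine Nat.lt_of_mul_lt_mul_left (a := N) ?_
        rw [mul_add, mul_comm N c]; omega
      have e2 : c < d + 1 := by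
        refine Nat.lt_of_mul_lt_mul_left (a := N) ?_
        rw [mul_add, mul_comm N c]; omega
      omega
    rw [this, mul_comm N] at hd
    omega

end RootsOfUnity

/-! ### The Todd series of the cone generated by `(1, 0)` and `(-q, N)` -/

/-- The cone generated by `(1, 0)` and `(-q, N)`. -/
def stdCone (N q : ℕ) : OrientedCone := ⟨![1, 0], ![-q, N]⟩

theorem stdCone_det (N q : ℕ) : (stdCone N q).mat.det = N := by
  simp [stdCone, OrientedCone.mat, Matrix.det_fin_two]

theorem mem_stdCone_sublattice (N q : ℕ) (w : Fin 2 → ℤ) :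
    w ∈ (stdCone N q).sublattice ↔ (N : ℤ) ∣ w 1 := by
  rw [OrientedCone.sublattice, AddSubgroup.mem_closure_pair]
  constructor
  · rintro ⟨x, y, rfl⟩
    simp [stdCone]
  · rintro ⟨c, hc⟩
    refine ⟨w 0 + c * q, c, ?_⟩
    funext j
    fin_cases j <;> simp [stdCone, hc, mul_comm]

theorem stdCone_coords {N : ℕ} (hN : 0 < N) (q : ℕ) (w : Fin 2 → ℤ) :
    (stdCone N q).coords w = ![(w 0 + q * w 1 / N : ℚ), (w 1 / N : ℚ)] := by
  have hN' : (N : ℚ) ≠ 0 := by positivity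
  rw [OrientedCone.coords, Matrix.inv_def]
  simp only [stdCone, OrientedCone.mat]
  funext j
  fin_cases j <;>
    simp [Matrix.det_fin_two, Matrix.adjugate_fin_two, Matrix.mulVec, dotProduct,
      Fin.sum_univ_two] <;> field_simp

theorem stdCone_char {N : ℕ} (hN : 0 < N) (q j : ℕ) :
    (stdCone N q).char 0 (QuotientAddGroup.mk ![0, (j : ℤ)]) =
      (Complex.exp (2 * Real.pi * Complex.I / N) ^ j) ^ q ∧
    (stdCone N q).char 1 (QuotientAddGroup.mk ![0, (j : ℤ)]) =
      Complex.exp (2 * Real.pi * Complex.I / N) ^ j := by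
  have hd : (stdCone N q).mat.det ≠ 0 := by
    rw [stdCone_det]; positivity
  rw [OrientedCone.char_mk _ hd, OrientedCone.char_mk _ hd, stdCone_coords hN, ← pow_mul,
    ← Complex.exp_nat_mul, ← Complex.exp_nat_mul]
  constructor
  · congr 1
    simp
    ring
  · congr 1
    simp
    ring

/-- The sublattice is cut out by `N ∣ w 1` alone, so the second coordinate modulo `N` classifies
cosets. -/
theorem bijective_stdCone {N : ℕ} (hN : 0 < N) (q : ℕ) :
    Function.Bijective
      (fun j : Fin N => (QuotientAddGroup.mk ![0, (j : ℤ)] : (stdCone N q).Gam)) := by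
  constructor
  · intro i j hij
    rw [QuotientAddGroup.eq, mem_stdCone_sublattice] at hij
    simp only [Pi.add_apply, Pi.neg_apply, Matrix.cons_val_one, Matrix.cons_val_fin_one] at hij
    have h := Int.eq_zero_of_abs_lt_dvd hij (by rw [abs_lt]; omega)
    ext
    omega
  · intro g
    obtain ⟨w, rfl⟩ := QuotientAddGroup.mk_surjective g
    have hN' : (0 : ℤ) < N := by exact_mod_cast hN
    refine ⟨⟨(w 1 % N).toNat, ?_⟩, ?_⟩
    · have := Int.emod_lt_of_pos (w 1) hN'
      omega
    · rw [QuotientAddGroup.eq, mem_stdCone_sublattice]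
      have h := Int.emod_nonneg (w 1) hN'.ne'
      simp only [Pi.add_apply, Pi.neg_apply, Matrix.cons_val_one, Matrix.cons_val_fin_one]
      rw [Int.toNat_of_nonneg h]
      have := Int.emod_add_mul_ediv (w 1) N
      exact ⟨w 1 / N, by linarith⟩

theorem todd_stdCone {N : ℕ} (hN : 0 < N) (q : ℕ) :
    todd (stdCone N q) = ∑ j ∈ Finset.range N,
      (toddTwist ((Complex.exp (2 * Real.pi * Complex.I / N) ^ j) ^ q)).subst
          (MvPowerSeries.X 0 : Ser) *
        (toddTwist (Complex.exp (2 * Real.pi * Complex.I / N) ^ j)).subst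
          (MvPowerSeries.X 1 : Ser) := by
  rw [todd, ← finsum_eq_of_bijective _ (bijective_stdCone hN q) (fun j => rfl),
    finsum_eq_sum_of_fintype, ← Fin.sum_univ_eq_sum_range (fun j => 
      (toddTwist ((Complex.exp (2 * Real.pi * Complex.I / N) ^ j) ^ q)).subst
          (MvPowerSeries.X 0 : Ser) *
        (toddTwist (Complex.exp (2 * Real.pi * Complex.I / N) ^ j)).subst
          (MvPowerSeries.X 1 : Ser))]
  refine Finset.sum_congr rfl fun j _ => ?_
  rw [(stdCone_char hN q j).1, (stdCone_char hN q j).2]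

instance : CharZero Ser :=
  charZero_of_injective_ringHom (f := (MvPowerSeries.C : ℂ →+* Ser)) (RingHom.injective _)

theorem X_ne_zero (i : Fin 2) : (MvPowerSeries.X i : Ser) ≠ 0 := by
  intro h
  have := congrArg (MvPowerSeries.coeff (Finsupp.single i 1)) h
  simp at this

theorem expMer_X_pow_ne_one (i : Fin 2) {n : ℕ} (hn : 0 < n) :
    expMer (MvPowerSeries.X i) ^ n ≠ 1 := by
  rw [← expMer_natCast_mul (by simp)]
  refine expMer_ne_one (by simp) (mul_ne_zero ?_ (X_ne_zero i))
  exact Nat.cast_ne_zero.mpr hn.ne'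

theorem algebraMap_toddTwist_subst_X (i : Fin 2) {N : ℕ} (hN : 0 < N) {lam : ℂ}
    (h : lam ^ N = 1) :
    algebraMap Ser Mer ((toddTwist lam).subst (MvPowerSeries.X i : Ser)) =
      algebraMap Ser Mer (MvPowerSeries.X i) *
        (1 / (1 - algebraMap Ser Mer (MvPowerSeries.C lam) * expMer (MvPowerSeries.X i))) := by
  rw [mul_one_div, eq_div_iff]
  · exact toddTwist_subst_mul (by simp) lam
  -- If the denominator vanished, its `N`-th power relation would give `exp(-N x_i) = 1`.
  · rw [sub_ne_zero]
    intro h0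
    apply expMer_X_pow_ne_one i hN
    have := congrArg (· ^ N) h0
    simpa [mul_pow, ← map_pow, h] using this.symm

/-- The Todd series as a staircase sum. -/
theorem algebraMap_todd_stdCone {N : ℕ} (hN : 0 < N) (q : ℕ) :
    algebraMap Ser Mer (todd (stdCone N q)) =
      algebraMap Ser Mer ((N : Ser) * MvPowerSeries.X 0 * MvPowerSeries.X 1) *
        (stair (expMer (MvPowerSeries.X 1) ^ N)
            (expMer (MvPowerSeries.X 0) * (expMer (MvPowerSeries.X 1) ^ q)⁻¹) N q /
          ((1 - expMer (MvPowerSeries.X 1) ^ N) * (1 - expMer (MvPowerSeries.X 0) ^ N))) := by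
  have hζ : IsPrimitiveRoot ((algebraMap Ser Mer).comp MvPowerSeries.C
      (Complex.exp (2 * Real.pi * Complex.I / N))) N :=
    (Complex.isPrimitiveRoot_exp N hN.ne').map_of_injective (RingHom.injective _)
  have h := sum_roots_eq_stair hN hζ q (expMer_X_pow_ne_one 0 hN) (expMer_X_pow_ne_one 1 hN)
    (expMer_ne_zero (by simp))
  rw [todd_stdCone hN, map_sum, map_mul, map_mul, map_natCast,
    show ∀ n a b s : Mer, n * a * b * s = n * s * (a * b) from fun _ _ _ _ => by ring,
    ← h, Finset.sum_mul]
  refine Finset.sum_congr rfl fun j _ => ?_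
  have h1 : (Complex.exp (2 * Real.pi * Complex.I / N) ^ j) ^ N = 1 := by
    rw [pow_right_comm, (Complex.isPrimitiveRoot_exp N hN.ne').pow_eq_one, one_pow]
  have h2 : ((Complex.exp (2 * Real.pi * Complex.I / N) ^ j) ^ q) ^ N = 1 := by
    rw [pow_right_comm, h1, one_pow]
  rw [map_mul, algebraMap_toddTwist_subst_X 0 hN h2, algebraMap_toddTwist_subst_X 1 hN h1]
  simp only [map_pow, RingHom.comp_apply]
  ring

/-! ### The cones and linear forms of a continued fraction -/

/-- The reversed sequence of partial quotients. -/
def revSeq (a : ℕ → ℕ) (ℓ : ℕ) (n : ℕ) : ℕ := a (ℓ - (n + 1))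

section Convergents

variable (a : ℕ → ℕ) (ℓ : ℕ)

theorem convMat_eq (i : ℕ) :
    convMat a ℓ i = !![(cfNum (revSeq a ℓ) (i + 1) : ℤ), (cfNum (revSeq a ℓ) i : ℤ);
      (cfDen (revSeq a ℓ) (i + 1) : ℤ), (cfDen (revSeq a ℓ) i : ℤ)] := by
  induction i with
  | zero =>
    rw [convMat, Matrix.one_fin_two]
    simp [cfNum, cfDen]
  | succ i ih =>
    rw [convMat, ih, Matrix.mul_fin_two]
    simp [cfNum, cfDen, revSeq, mul_comm]

theorem convVec_sub_one (n : ℕ) :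
    convVec a ℓ ((n : ℤ) - 1) =
      ![(cfNum (revSeq a ℓ) n : ℤ), (cfDen (revSeq a ℓ) n : ℤ)] := by
  cases n with
  | zero => simp [convVec, cfNum, cfDen]
  | succ n =>
    have h : ¬ (n : ℤ) = -1 := by omega
    funext j
    fin_cases j <;> simp [convVec, h, convMat_eq]

theorem convVec_natCast (n : ℕ) :
    convVec a ℓ (n : ℤ) =
      ![(cfNum (revSeq a ℓ) (n + 1) : ℤ), (cfDen (revSeq a ℓ) (n + 1) : ℤ)] := by
  simpa using convVec_sub_one a ℓ (n + 1)

theorem cfα_sub_one (n : ℕ) : cfα a ℓ ((n : ℤ) - 1) = cfNum (revSeq a ℓ) n := by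
  simp [cfα, convVec_sub_one]

theorem cfβ_sub_one (n : ℕ) : cfβ a ℓ ((n : ℤ) - 1) = cfDen (revSeq a ℓ) n := by
  simp [cfβ, convVec_sub_one]

theorem piece_zero : piece a ℓ 0 = ⟨![0, -1], ![1, 0]⟩ := by
  have h0 := convVec_sub_one a ℓ 0
  have h1 := convVec_natCast a ℓ 0
  simp only [Nat.cast_zero, zero_sub, cfNum, cfDen] at h0 h1
  rw [piece, if_pos rfl, h0, h1]
  ext j <;> fin_cases j <;> simp

theorem piece_succ (n : ℕ) : piece a ℓ (n + 1) =
    ⟨![(cfNum (revSeq a ℓ) (n + 1) : ℤ), (cfDen (revSeq a ℓ) (n + 1) : ℤ)],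
      ![(cfNum (revSeq a ℓ) (n + 2) : ℤ), (cfDen (revSeq a ℓ) (n + 2) : ℤ)]⟩ := by
  rw [piece, if_neg (Nat.succ_ne_zero n), convVec_sub_one, convVec_natCast]

theorem tauCone_eq : tauCone a ℓ =
    ⟨![0, -1], ![(cfNum (revSeq a ℓ) ℓ : ℤ), (cfDen (revSeq a ℓ) ℓ : ℤ)]⟩ := by
  rw [tauCone, convVec_sub_one]

theorem idealCone_eq : idealCone a ℓ =
    ⟨![0, 1], ![(cfNum (revSeq a ℓ) ℓ : ℤ), (cfDen (revSeq a ℓ) ℓ : ℤ)]⟩ := by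
  rw [idealCone, convVec_sub_one]

theorem idealCone_det : (idealCone a ℓ).mat.det = -cfNum (revSeq a ℓ) ℓ := by
  rw [idealCone_eq]
  simp [OrientedCone.mat, Matrix.det_fin_two]

theorem piece_succ_det (n : ℕ) : (piece a ℓ (n + 1)).mat.det = (-1) ^ n := by
  have h := cfNum_mul_cfDen_sub (revSeq a ℓ) (n + 1)
  rw [pow_succ, pow_succ, mul_assoc, neg_one_mul, neg_neg, mul_one] at h
  rw [piece_succ, ← h]
  simp [OrientedCone.mat, Matrix.det_fin_two]

theorem idealCone_dual_eq (h : 0 < cfNum (revSeq a ℓ) ℓ) :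
    (idealCone a ℓ).dual = stdCone (cfNum (revSeq a ℓ) ℓ) (cfDen (revSeq a ℓ) ℓ) := by
  have hs : (idealCone a ℓ).mat.det.sign = -1 := by
    rw [idealCone_det]
    exact Int.sign_eq_neg_one_of_neg (by omega)
  rw [OrientedCone.dual, hs, idealCone_eq]
  ext j <;> fin_cases j <;> simp [stdCone]

theorem isCoprime_cfNum_cfDen (n : ℕ) :
    IsCoprime (cfNum (revSeq a ℓ) n : ℤ) (cfDen (revSeq a ℓ) n : ℤ) := by
  have h := cfNum_mul_cfDen_sub (revSeq a ℓ) n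
  -- Bézout coefficients read off from the determinant `±1` with the next convergent vector.
  refine ⟨(-1) ^ (n + 1) * cfDen (revSeq a ℓ) (n + 1),
    -((-1) ^ (n + 1) * cfNum (revSeq a ℓ) (n + 1)), ?_⟩
  have h2 : ((-1 : ℤ) ^ (n + 1)) * (-1) ^ (n + 1) = 1 := by
    rw [← mul_pow]; simp
  generalize ((-1 : ℤ) ^ (n + 1)) = s at *
  linear_combination s * h + h2

theorem idealCone_isLatticeCone (h : 0 < cfNum (revSeq a ℓ) ℓ) :
    (idealCone a ℓ).IsLatticeCone := by
  refine ⟨?_, ?_, ?_⟩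
  · rw [idealCone_eq]
    exact isCoprime_one_right
  · rw [idealCone_eq]
    exact isCoprime_cfNum_cfDen a ℓ ℓ
  · rw [idealCone_det]
    omega

theorem idealCone_dual_isLatticeCone (h : 0 < cfNum (revSeq a ℓ) ℓ) :
    (idealCone a ℓ).dual.IsLatticeCone := by
  rw [idealCone_dual_eq a ℓ h]
  refine ⟨isCoprime_one_left, ?_, ?_⟩
  · exact (isCoprime_cfNum_cfDen a ℓ ℓ).symm.neg_left
  · rw [stdCone_det]
    omega

theorem idealCone_dual_similar (h : 0 < cfNum (revSeq a ℓ) ℓ) :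
    (idealCone a ℓ).dual.Similar (tauCone a ℓ) := by
  rw [idealCone_dual_eq a ℓ h, tauCone_eq]
  -- A quarter turn takes `(1,0)` to `(0,-1)` and `(-q,N)` to `(N,q)`.
  refine ⟨⟨!![0, 1; -1, 0], !![0, -1; 1, 0], ?_, ?_⟩, ?_⟩
  · simp [Matrix.one_fin_two]
  · simp [Matrix.one_fin_two]
  · simp [stdCone, OrientedCone.mat]

theorem piece_isNonsingular (i : ℕ) : (piece a ℓ i).IsNonsingular := by
  cases i with
  | zero =>
    have hd : (piece a ℓ 0).mat.det = 1 := by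
      rw [piece_zero]
      simp [OrientedCone.mat, Matrix.det_fin_two]
    refine ⟨⟨?_, ?_, by rw [hd]; exact one_ne_zero⟩, Or.inl hd⟩
    · rw [piece_zero]
      exact isCoprime_one_right.neg_right
    · rw [piece_zero]
      exact isCoprime_one_left
  | succ n =>
    have hd := piece_succ_det a ℓ n
    have hd' := neg_one_pow_eq_or ℤ n
    rw [← hd] at hd'
    refine ⟨⟨?_, ?_, by rw [hd]; exact pow_ne_zero _ (by norm_num)⟩, hd'⟩
    · rw [piece_succ]
      exact isCoprime_cfNum_cfDen a ℓ (n + 1)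
    · rw [piece_succ]
      exact isCoprime_cfNum_cfDen a ℓ (n + 2)

/-- The vectors cutting `τ` into nonsingular cones. -/
def cutVec (n : ℕ) : Fin 2 → ℤ :=
  if n = 0 then ![0, -1] else ![(cfNum (revSeq a ℓ) n : ℤ), (cfDen (revSeq a ℓ) n : ℤ)]

theorem cutVec_det_ne_zero (hb : ∀ n, 0 < revSeq a ℓ n) {m n : ℕ} (h : m ≠ n) :
    cutVec a ℓ m 0 * cutVec a ℓ n 1 - cutVec a ℓ n 0 * cutVec a ℓ m 1 ≠ 0 := by
  have hd := det_convergents_ne_zero hb h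
  by_cases hm : m = 0
  · by_cases hn : n = 0
    · omega
    · simpa [cutVec, hm, hn, cfNum, cfDen] using hd
  · by_cases hn : n = 0
    · simpa [cutVec, hm, hn, cfNum, cfDen] using hd
    · simpa [cutVec, hm, hn] using hd

theorem tauCone_isVirtualSum (hb : ∀ n, 0 < revSeq a ℓ n) (hℓ : ℓ ≠ 0) :
    IsVirtualSum (tauCone a ℓ) (fun i : Fin ℓ => piece a ℓ i) := by
  -- The half plane is the one of nonnegative first coordinate; `(0,-1)` lies on its boundary.
  refine ⟨fun i => cutVec a ℓ i, fun i => ?_, fun i j hij => ?_, ⟨![1, 0], ?_, fun i => ?_⟩,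
    fun i => ?_, ?_⟩
  · by_cases hi : (i : ℕ) = 0
    · simp only [cutVec, if_pos hi]
      exact isCoprime_one_right.neg_right
    · simp only [cutVec, if_neg hi]
      exact isCoprime_cfNum_cfDen a ℓ i
  · exact cutVec_det_ne_zero a ℓ hb (by simpa [Fin.ext_iff] using hij)
  · intro h
    simpa using congrFun h 0
  · by_cases hi : (i : ℕ) = 0 <;> simp [cutVec, hi]
  · obtain ⟨i, hi⟩ := i
    cases i with
    | zero => simp [cutVec, piece_zero, cfNum, cfDen]
    | succ n => simp [cutVec, piece_succ]
  · simp [cutVec, hℓ, tauCone_eq]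

end Convergents

/-! ### Change of coordinates -/

/-- For determinant `s = ±1` the inverse matrix is `s` times the adjugate, so the coordinate forms
are integral. -/
theorem changeCoords_of_det {ρ τ : OrientedCone} {s : ℤ} (hd : ρ.mat.det = s) (hs : s * s = 1) :
    changeCoords ρ τ 0 = (s : Ser) *
      (((ρ.v₂ 1 * τ.v₁ 0 - ρ.v₂ 0 * τ.v₁ 1 : ℤ) : Ser) * MvPowerSeries.X 0 +
        ((ρ.v₂ 1 * τ.v₂ 0 - ρ.v₂ 0 * τ.v₂ 1 : ℤ) : Ser) * MvPowerSeries.X 1) ∧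
    changeCoords ρ τ 1 = (s : Ser) *
      (((ρ.v₁ 0 * τ.v₁ 1 - ρ.v₁ 1 * τ.v₁ 0 : ℤ) : Ser) * MvPowerSeries.X 0 +
        ((ρ.v₁ 0 * τ.v₂ 1 - ρ.v₁ 1 * τ.v₂ 0 : ℤ) : Ser) * MvPowerSeries.X 1) := by
  have hdet : (ρ.mat.map (Int.cast : ℤ → ℂ)).det = s := by
    rw [← hd]
    simp [Matrix.det_fin_two]
  have hinv : (ρ.mat.map (Int.cast : ℤ → ℂ))⁻¹ =
      (s : ℂ) • (ρ.mat.map (Int.cast : ℤ → ℂ)).adjugate := by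
    rw [Matrix.inv_def, hdet, Ring.inverse_eq_inv']
    congr 1
    apply inv_eq_of_mul_eq_one_left
    exact_mod_cast hs
  constructor <;>
  · rw [changeCoords, hinv]
    simp [Matrix.mulVec, Matrix.vecMul, dotProduct, Fin.sum_univ_two,
      Matrix.adjugate_fin_two, OrientedCone.mat]
    ring

/-! ### The Todd series as a sum over the convergents -/

section ToddSum

variable (a : ℕ → ℕ) (ℓ : ℕ)

/-- The linear form `x₁ - β x₂`, where `β` is the second coordinate of the last convergent. -/
noncomputable def baseForm : Ser :=
  MvPowerSeries.X 0 - (cfDen (revSeq a ℓ) ℓ : Ser) * MvPowerSeries.X 1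

/-- The linear form `α x₂`, where `α` is the first coordinate of the last convergent. -/
noncomputable def endForm : Ser := (cfNum (revSeq a ℓ) ℓ : Ser) * MvPowerSeries.X 1

theorem constantCoeff_baseForm : MvPowerSeries.constantCoeff (baseForm a ℓ) = 0 := by
  simp [baseForm]

theorem constantCoeff_endForm : MvPowerSeries.constantCoeff (endForm a ℓ) = 0 := by
  simp [endForm]

theorem cfM_sub_one (n : ℕ) : cfM a ℓ ((n : ℤ) - 1) = (-1) ^ n *
    ((cfNum (revSeq a ℓ) n : Ser) * baseForm a ℓ + (cfDen (revSeq a ℓ) n : Ser) * endForm a ℓ) := by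
  rw [cfM, cfα_sub_one, cfβ_sub_one, cfα_sub_one, cfβ_sub_one, MvPowerSeries.smul_eq_C_mul,
    baseForm, endForm]
  simp
  ring

theorem cfM_natCast (n : ℕ) : cfM a ℓ n = (-1) ^ (n + 1) *
    ((cfNum (revSeq a ℓ) (n + 1) : Ser) * baseForm a ℓ +
      (cfDen (revSeq a ℓ) (n + 1) : Ser) * endForm a ℓ) := by
  simpa using cfM_sub_one a ℓ (n + 1)

/-- The `x₁`-coefficient is `cfNum n`, positive for `n ≥ 1`; for `n = 0` the form is `α_{ℓ-1} x₂`.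
-/
theorem combination_ne_zero (hb : ∀ n, 0 < revSeq a ℓ n) (hℓ : ℓ ≠ 0) (n : ℕ) :
    (cfNum (revSeq a ℓ) n : Ser) * baseForm a ℓ +
      (cfDen (revSeq a ℓ) n : Ser) * endForm a ℓ ≠ 0 := by
  intro h
  have key : ∀ m : ℕ, (m : Ser) = MvPowerSeries.C (m : ℂ) := fun m => by simp
  obtain ⟨k, rfl⟩ := Nat.exists_eq_succ_of_ne_zero hℓ
  cases n with
  | zero =>
    have hN := cfNum_pos hb k
    simp only [cfNum, cfDen, endForm, Nat.cast_zero, zero_mul, Nat.cast_one, one_mul, zero_add,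
      mul_eq_zero, Nat.cast_eq_zero, X_ne_zero, or_false] at h
    exact hN.ne' h
  | succ n =>
    have h1 := congrArg (MvPowerSeries.coeff (Finsupp.single 0 1)) h
    have hn := cfNum_pos hb n
    simp only [baseForm, endForm, key, map_add, mul_sub, map_sub, MvPowerSeries.coeff_C_mul,
      MvPowerSeries.coeff_X, map_zero] at h1
    simp [Finsupp.single_left_inj] at h1
    exact hn.ne' h1

theorem cfM_ne_zero (hb : ∀ n, 0 < revSeq a ℓ n) (hℓ : ℓ ≠ 0) (n : ℕ) :
    cfM a ℓ ((n : ℤ) - 1) ≠ 0 := by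
  rw [cfM_sub_one]
  exact mul_ne_zero (pow_ne_zero _ (neg_ne_zero.mpr one_ne_zero))
    (combination_ne_zero a ℓ hb hℓ n)

theorem expMer_combination (m n : ℕ) :
    expMer ((m : Ser) * baseForm a ℓ + (n : Ser) * endForm a ℓ) =
      expMer (baseForm a ℓ) ^ m * expMer (endForm a ℓ) ^ n := by
  rw [expMer_add, expMer_natCast_mul (constantCoeff_baseForm a ℓ),
    expMer_natCast_mul (constantCoeff_endForm a ℓ)]
  · simp [constantCoeff_baseForm]
  · simp [constantCoeff_endForm]

theorem expMer_cfM (n : ℕ) : expMer (cfM a ℓ ((n : ℤ) - 1)) =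
    if Even n then expMer (baseForm a ℓ) ^ cfNum (revSeq a ℓ) n *
      expMer (endForm a ℓ) ^ cfDen (revSeq a ℓ) n
    else (expMer (baseForm a ℓ) ^ cfNum (revSeq a ℓ) n *
      expMer (endForm a ℓ) ^ cfDen (revSeq a ℓ) n)⁻¹ := by
  rw [cfM_sub_one, ← expMer_combination]
  split_ifs with h
  · rw [h.neg_one_pow, one_mul]
  · rw [(Nat.not_even_iff_odd.mp h).neg_one_pow, neg_one_mul, expMer_neg]
    simp [constantCoeff_baseForm, constantCoeff_endForm]

variable {a ℓ}

/-- The staircase telescoping with `W = exp(-baseForm)` and `T = exp(-endForm)`, for which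
`exp(-x₁)^N = W^N T^q`. -/
theorem algebraMap_todd_dual (hb : ∀ n, 0 < revSeq a ℓ n) (hℓ : ℓ ≠ 0) :
    algebraMap Ser Mer (todd (idealCone a ℓ).dual) =
      algebraMap Ser Mer
          ((cfNum (revSeq a ℓ) ℓ : Ser) * MvPowerSeries.X 0 * MvPowerSeries.X 1) *
        (toddF (baseForm a ℓ) (endForm a ℓ) +
          ∑ i ∈ Finset.Icc 1 (ℓ - 1), (-1 : Mer) ^ (i - 1) *
            toddF (cfM a ℓ i) (cfM a ℓ ((i : ℤ) - 1))) := by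
  obtain ⟨k, rfl⟩ := Nat.exists_eq_succ_of_ne_zero hℓ
  have hN := cfNum_pos hb k
  rw [idealCone_dual_eq a _ hN, algebraMap_todd_stdCone hN]
  congr 1
  have hW : expMer (baseForm a (k + 1)) = expMer (MvPowerSeries.X 0) *
      (expMer (MvPowerSeries.X 1) ^ cfDen (revSeq a (k + 1)) (k + 1))⁻¹ := by
    rw [baseForm, sub_eq_add_neg, expMer_add (by simp) (by simp), expMer_neg (by simp),
      expMer_natCast_mul (by simp)]
  have hT : expMer (endForm a (k + 1)) =
      expMer (MvPowerSeries.X 1) ^ cfNum (revSeq a (k + 1)) (k + 1) := by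
    rw [endForm, expMer_natCast_mul (by simp)]
  have hX : expMer (MvPowerSeries.X 0) ^ cfNum (revSeq a (k + 1)) (k + 1) =
      expMer (baseForm a (k + 1)) ^ cfNum (revSeq a (k + 1)) (k + 1) *
        expMer (endForm a (k + 1)) ^ cfDen (revSeq a (k + 1)) (k + 1) := by
    rw [hW, hT, mul_pow, inv_pow, pow_right_comm, mul_assoc, inv_mul_cancel₀, mul_one]
    exact pow_ne_zero _ (pow_ne_zero _ (expMer_ne_zero (by simp)))
  have h := stair_div_eq_sum hb (expMer_ne_zero (constantCoeff_endForm a (k + 1)))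
    (expMer_ne_zero (constantCoeff_baseForm a (k + 1)))
    (fun n => by
      rw [← expMer_combination]
      exact expMer_ne_one (by simp [constantCoeff_baseForm, constantCoeff_endForm])
        (combination_ne_zero a _ hb hℓ n))
    (fun n => expMer (cfM a (k + 1) ((n : ℤ) - 1))) (expMer_cfM a (k + 1)) k
  rw [hX, ← hT, ← hW]
  simp only [Nat.succ_eq_add_one, Nat.add_sub_cancel]
  rw [h, toddF_eq]
  congr 1
  refine Finset.sum_congr rfl fun i _ => ?_
  rw [toddF_eq]
  simp

theorem toddF_piece_zero :
    toddF (changeCoords (piece a ℓ 0) (tauCone a ℓ) 0)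
      (changeCoords (piece a ℓ 0) (tauCone a ℓ) 1) = toddF (baseForm a ℓ) (endForm a ℓ) := by
  have hd : (piece a ℓ 0).mat.det = 1 := by
    rw [piece_zero]
    simp [OrientedCone.mat, Matrix.det_fin_two]
  obtain ⟨h0, h1⟩ := changeCoords_of_det (τ := tauCone a ℓ) hd rfl
  rw [h0, h1, piece_zero, tauCone_eq, baseForm, endForm]
  congr 1
  · simp
    ring
  · simp

theorem toddF_piece_succ (n : ℕ) :
    toddF (changeCoords (piece a ℓ (n + 1)) (tauCone a ℓ) 0)
      (changeCoords (piece a ℓ (n + 1)) (tauCone a ℓ) 1) =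
    toddF (cfM a ℓ ((n + 1 : ℕ) : ℤ)) (cfM a ℓ (((n + 1 : ℕ) : ℤ) - 1)) := by
  have hs : ((-1 : ℤ) ^ n) * (-1) ^ n = 1 := by
    rw [← mul_pow]; simp
  obtain ⟨h0, h1⟩ := changeCoords_of_det (τ := tauCone a ℓ) (piece_succ_det a ℓ n) hs
  rw [h0, h1, piece_succ, tauCone_eq, cfM_natCast, cfM_sub_one, baseForm, endForm]
  congr 1
  · simp [pow_succ]
    ring
  · simp [pow_succ]
    ring

theorem normTodd_dual (hb : ∀ n, 0 < revSeq a ℓ n) (hℓ : ℓ ≠ 0) :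
    normTodd (idealCone a ℓ).dual =
      toddF (changeCoords (piece a ℓ 0) (tauCone a ℓ) 0)
          (changeCoords (piece a ℓ 0) (tauCone a ℓ) 1) +
        ∑ i ∈ Finset.Icc 1 (ℓ - 1), (-1 : Mer) ^ (i - 1) *
          toddF (changeCoords (piece a ℓ i) (tauCone a ℓ) 0)
            (changeCoords (piece a ℓ i) (tauCone a ℓ) 1) := by
  obtain ⟨k, rfl⟩ := Nat.exists_eq_succ_of_ne_zero hℓ
  have hN := cfNum_pos hb k
  have hd : (((idealCone a (k + 1)).dual.mat.det : ℤ) : Ser) =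
      (cfNum (revSeq a (k + 1)) (k + 1) : Ser) := by
    rw [idealCone_dual_eq a _ hN, stdCone_det, Int.cast_natCast]
  rw [normTodd, hd, algebraMap_todd_dual hb hℓ, toddF_piece_zero]
  rw [mul_div_cancel_left₀]
  · rw [add_right_inj]
    refine Finset.sum_congr rfl fun i hi => ?_
    obtain ⟨n, rfl⟩ := Nat.exists_eq_succ_of_ne_zero (n := i) (by
      have := (Finset.mem_Icc.mp hi).1
      omega)
    rw [Nat.succ_eq_add_one, toddF_piece_succ]
  · exact algebraMap_ne_zero (mul_ne_zero (mul_ne_zero (Nat.cast_ne_zero.mpr hN.ne')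
      (X_ne_zero 0)) (X_ne_zero 1))

theorem sum_Icc_neg_one {M : Type*} [AddCommMonoid M] (ℓ : ℕ) (g : ℤ → M) :
    ∑ i ∈ Finset.Icc (-1 : ℤ) (ℓ - 2), g i = ∑ n ∈ Finset.range ℓ, g ((n : ℤ) - 1) := by
  symm
  refine Finset.sum_bij (fun n _ => (n : ℤ) - 1) ?_ ?_ ?_ fun _ _ => rfl
  · intro n hn
    rw [Finset.mem_range] at hn
    rw [Finset.mem_Icc]
    omega
  · intro m _ n _ h
    omega
  · intro i hi
    rw [Finset.mem_Icc] at hi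
    exact ⟨(i + 1).toNat, by rw [Finset.mem_range]; omega, by omega⟩

/-- Absorbs the initial cone into the sum as the term `i = -1`. Since `M_{-1} = endForm` and `M_0 =
-baseForm`, reversing the sign of `baseForm` leaves the extra summand `1/(1 - T)`. -/
theorem algebraMap_todd_dual_eq_cfM_sum (hb : ∀ n, 0 < revSeq a ℓ n) (hℓ : ℓ ≠ 0) :
    algebraMap Ser Mer (todd (idealCone a ℓ).dual) =
      algebraMap Ser Mer
          ((cfNum (revSeq a ℓ) ℓ : Ser) * MvPowerSeries.X 0 * MvPowerSeries.X 1) *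
        (∑ n ∈ Finset.range ℓ, -((-1 : Mer) ^ n *
            toddF (cfM a ℓ ((n : ℤ) - 1)) (cfM a ℓ n)) +
          1 / (1 - expMer (endForm a ℓ))) := by
  rw [algebraMap_todd_dual hb hℓ]
  obtain ⟨k, rfl⟩ := Nat.exists_eq_succ_of_ne_zero hℓ
  congr 1
  rw [Nat.succ_eq_add_one, Finset.sum_range_succ', Nat.add_sub_cancel, Finset.range_eq_Ico,
    Finset.sum_Ico_add' (fun n : ℕ => -((-1 : Mer) ^ n * toddF (cfM a (k + 1) ((n : ℤ) - 1))
      (cfM a (k + 1) n))) 0 k 1, add_assoc, add_comm]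
  congr 1
  · refine Finset.sum_congr rfl fun i hi => ?_
    obtain ⟨n, rfl⟩ := Nat.exists_eq_succ_of_ne_zero (n := i) (by
      have := (Finset.mem_Icc.mp hi).1
      omega)
    rw [toddF_comm, Nat.succ_eq_add_one, Nat.add_sub_cancel, pow_succ]
    ring
  · have e0 : cfM a (k + 1) (((0 : ℕ) : ℤ) - 1) = endForm a (k + 1) := by
      rw [cfM_sub_one]
      simp [cfNum, cfDen]
    have e1 : cfM a (k + 1) ((0 : ℕ) : ℤ) = -baseForm a (k + 1) := by
      rw [cfM_natCast]
      simp [cfNum, cfDen]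
    have hz : expMer (baseForm a (k + 1)) ≠ 0 := expMer_ne_zero (constantCoeff_baseForm a _)
    have h1 : 1 - expMer (baseForm a (k + 1)) ≠ 0 := by
      refine sub_ne_zero.mpr (expMer_ne_one (constantCoeff_baseForm a _) ?_).symm
      simpa [cfNum, cfDen] using combination_ne_zero a (k + 1) hb hℓ 1
    have h2 : 1 - (expMer (baseForm a (k + 1)))⁻¹ ≠ 0 := by
      rw [sub_ne_zero]
      contrapose! h1
      rw [sub_eq_zero, eq_comm, ← inv_eq_one]
      exact h1.symm
    rw [e0, e1, toddF_eq, toddF_eq, expMer_neg (constantCoeff_baseForm a _)]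
    generalize expMer (baseForm a (k + 1)) = W at *
    have ei : 1 / (1 - W⁻¹) = - W / (1 - W) := by
      rw [div_eq_div_iff h2 h1]
      linear_combination -mul_inv_cancel₀ hz
    have ej : 1 / (1 - W) = 1 - 1 / (1 - W⁻¹) := by
      rw [ei]
      field_simp
      ring
    rw [ej]
    ring

end ToddSum

/-! ### Homogeneous components -/

section Homogeneous

theorem homogeneousComponent_mul (n : ℕ) (f g : Ser) :
    MvPowerSeries.homogeneousComponent n (f * g) = ∑ p ∈ Finset.HasAntidiagonal.antidiagonal n,
      MvPowerSeries.homogeneousComponent p.1 f * MvPowerSeries.homogeneousComponent p.2 g := by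
  ext e
  rw [MvPowerSeries.coeff_homogeneousComponent, map_sum]
  simp only [MvPowerSeries.coeff_mul, MvPowerSeries.coeff_homogeneousComponent]
  rw [Finset.sum_comm]
  have hdeg : ∀ u ∈ Finset.HasAntidiagonal.antidiagonal e, e.degree = u.1.degree + u.2.degree :=
    fun u hu => by rw [← Finset.HasAntidiagonal.mem_antidiagonal.mp hu, map_add]
  split_ifs with h
  · refine Finset.sum_congr rfl fun u hu => ?_
    rw [Finset.sum_eq_single_of_mem (u.1.degree, u.2.degree)]
    · simp
    · rw [Finset.HasAntidiagonal.mem_antidiagonal, ← hdeg u hu, h]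
    · intro p _ hp
      by_cases h1 : u.1.degree = p.1
      · by_cases h2 : u.2.degree = p.2
        · exact absurd (Prod.ext h1.symm h2.symm) hp
        · simp [h2]
      · simp [h1]
  · refine (Finset.sum_eq_zero fun u hu => Finset.sum_eq_zero fun p hp => ?_).symm
    rw [Finset.HasAntidiagonal.mem_antidiagonal] at hp
    by_cases h1 : u.1.degree = p.1
    · by_cases h2 : u.2.degree = p.2
      · have := hdeg u hu
        omega
      · simp [h2]
    · simp [h1]

theorem homogeneousComponent_of_isHomogeneous {f : Ser} {d : ℕ} (hf : f.IsHomogeneous d) (n : ℕ) :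
    MvPowerSeries.homogeneousComponent n f = if n = d then f else 0 := by
  ext e
  rw [MvPowerSeries.coeff_homogeneousComponent]
  by_cases he : e.degree = d
  · subst he
    simp only [eq_comm (a := n)]
    split_ifs <;> simp
  · rw [hf.coeff_eq_zero he]
    split_ifs <;> simp [hf.coeff_eq_zero he]

/-- A homogeneous factor only shifts the grading; this makes clearing homogeneous denominators
compatible with components. -/
theorem homogeneousComponent_isHomogeneous_mul {h : Ser} {d : ℕ} (hh : h.IsHomogeneous d) (n : ℕ)
    (f : Ser) : MvPowerSeries.homogeneousComponent (n + d) (h * f) =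
      h * MvPowerSeries.homogeneousComponent n f := by
  rw [homogeneousComponent_mul, Finset.sum_eq_single_of_mem (d, n)]
  · rw [homogeneousComponent_of_isHomogeneous hh, if_pos rfl]
  · rw [Finset.HasAntidiagonal.mem_antidiagonal, add_comm]
  · intro p hp hne
    rw [Finset.HasAntidiagonal.mem_antidiagonal] at hp
    rw [homogeneousComponent_of_isHomogeneous hh, if_neg, zero_mul]
    rintro h1
    exact hne (Prod.ext h1 (by dsimp only; omega))

theorem IsHomogeneous.pow {f : Ser} {d : ℕ} (hf : f.IsHomogeneous d) (n : ℕ) :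
    (f ^ n).IsHomogeneous (d * n) := by
  induction n with
  | zero =>
    intro e he
    by_contra h
    apply he
    rw [pow_zero, MvPowerSeries.coeff_one, if_neg]
    rintro rfl
    simp at h
  | succ n ih => exact ih.mul hf

theorem isHomogeneous_C_mul {f : Ser} {d : ℕ} (hf : f.IsHomogeneous d) (c : ℂ) :
    (MvPowerSeries.C c * f).IsHomogeneous d := by
  intro e he
  rw [MvPowerSeries.coeff_C_mul] at he
  exact hf (right_ne_zero_of_mul he)

theorem isHomogeneous_X (i : Fin 2) : (MvPowerSeries.X i : Ser).IsHomogeneous 1 := by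
  intro e he
  rw [MvPowerSeries.coeff_X] at he
  simp only [ne_eq, ite_eq_right_iff, not_forall] at he
  rw [he.1, Finsupp.weight_single]
  simp

theorem constantCoeff_of_isHomogeneous_one {A : Ser} (hA : A.IsHomogeneous 1) :
    MvPowerSeries.constantCoeff A = 0 := by
  rw [← MvPowerSeries.coeff_zero_eq_constantCoeff_apply]
  exact hA.coeff_eq_zero (by simp)

/-- The power `A^m` is homogeneous of degree `m`, so only the `n`-th term of `f` contributes in
degree `n`. -/
theorem homogeneousComponent_subst {A : Ser} (hA : A.IsHomogeneous 1) (f : PowerSeries ℂ) (n : ℕ) :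
    MvPowerSeries.homogeneousComponent n (f.subst A) =
      MvPowerSeries.C (PowerSeries.coeff n f) * A ^ n := by
  have hpow (m : ℕ) : MvPowerSeries.IsHomogeneous (A ^ m) m := by
    have h : MvPowerSeries.IsHomogeneous (A ^ m) (1 * m) := IsHomogeneous.pow hA m
    rwa [one_mul] at h
  ext e
  rw [MvPowerSeries.coeff_homogeneousComponent, MvPowerSeries.coeff_C_mul]
  split_ifs with h
  · rw [PowerSeries.coeff_subst (hasSubst_of_zero (constantCoeff_of_isHomogeneous_one hA)),
      finsum_eq_single _ n]
    · simp
    · intro m hm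
      rw [MvPowerSeries.IsHomogeneous.coeff_eq_zero (hpow m) (by omega), smul_zero]
  · rw [MvPowerSeries.IsHomogeneous.coeff_eq_zero (hpow n) h, mul_zero]

/-- The quotient `z` of power series has `w` as its component of degree `n`: there are a homogeneous
denominator `h ≠ 0` and a series `g` with `h z = g`, and `h w` is the corresponding homogeneous
component of `g`. -/
def HasComponent (n : ℕ) (z w : Mer) : Prop :=
  ∃ (d : ℕ) (h g : Ser), h.IsHomogeneous d ∧ h ≠ 0 ∧
    algebraMap Ser Mer h * z = algebraMap Ser Mer g ∧
    algebraMap Ser Mer h * w =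
      algebraMap Ser Mer (MvPowerSeries.homogeneousComponent (n + d) g)

theorem HasComponent.zero (n : ℕ) : HasComponent n 0 0 := by
  refine ⟨0, 1, 0, ?_, one_ne_zero, by simp, by simp⟩
  have h : MvPowerSeries.IsHomogeneous ((MvPowerSeries.X 0 : Ser) ^ 0) (1 * 0) :=
    IsHomogeneous.pow (isHomogeneous_X 0) 0
  rwa [pow_zero, mul_zero] at h

theorem HasComponent.add {n : ℕ} {z w z' w' : Mer} (h : HasComponent n z w)
    (h' : HasComponent n z' w') : HasComponent n (z + z') (w + w') := by
  obtain ⟨d, D, g, hD, hD0, hz, hw⟩ := h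
  obtain ⟨d', D', g', hD', hD0', hz', hw'⟩ := h'
  refine ⟨d + d', D * D', D' * g + D * g', hD.mul hD', mul_ne_zero hD0 hD0', ?_, ?_⟩
  · rw [map_mul, map_add, map_mul, map_mul, ← hz, ← hz']
    ring
  · rw [map_add, ← add_assoc, homogeneousComponent_isHomogeneous_mul hD', add_right_comm,
      homogeneousComponent_isHomogeneous_mul hD, map_add, map_mul, map_mul, map_mul, ← hw, ← hw']
    ring

theorem HasComponent.sum {ι : Type*} {n : ℕ} (s : Finset ι) {z w : ι → Mer}
    (h : ∀ i ∈ s, HasComponent n (z i) (w i)) :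
    HasComponent n (∑ i ∈ s, z i) (∑ i ∈ s, w i) := by
  classical
  induction s using Finset.induction_on with
  | empty => exact HasComponent.zero n
  | insert i s hi ih =>
    rw [Finset.sum_insert hi, Finset.sum_insert hi]
    exact (h i (Finset.mem_insert_self i s)).add
      (ih fun j hj => h j (Finset.mem_insert_of_mem hj))

theorem HasComponent.mul_left {n e : ℕ} {z w : Mer} (h : HasComponent n z w) {p : Ser}
    (hp : p.IsHomogeneous e) :
    HasComponent (n + e) (algebraMap Ser Mer p * z) (algebraMap Ser Mer p * w) := by
  obtain ⟨d, D, g, hD, hD0, hz, hw⟩ := h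
  refine ⟨d, D, p * g, hD, hD0, ?_, ?_⟩
  · rw [mul_left_comm, hz, map_mul]
  · rw [mul_left_comm, hw, add_right_comm, homogeneousComponent_isHomogeneous_mul hp, map_mul]

/-- When the quotient is an actual power series, the component is its usual one, whatever
denominator was used. Graded pieces of a sum of quotients can thus be computed termwise. -/
theorem HasComponent.eq_homogeneousComponent {n : ℕ} {f : Ser} {w : Mer}
    (h : HasComponent n (algebraMap Ser Mer f) w) :
    algebraMap Ser Mer (MvPowerSeries.homogeneousComponent n f) = w := by
  obtain ⟨d, D, g, hD, hD0, hz, hw⟩ := h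
  apply mul_left_cancel₀ (algebraMap_ne_zero hD0)
  rw [← map_mul] at hz
  rw [hw, ← IsFractionRing.injective Ser Mer hz, homogeneousComponent_isHomogeneous_mul hD, map_mul]

theorem hasComponent_div {n d : ℕ} {h : Ser} (hh : h.IsHomogeneous d) (h0 : h ≠ 0) (g : Ser) :
    HasComponent n (algebraMap Ser Mer g / algebraMap Ser Mer h)
      (algebraMap Ser Mer (MvPowerSeries.homogeneousComponent (n + d) g) / algebraMap Ser Mer h) :=
  ⟨d, h, g, hh, h0, mul_div_cancel₀ _ (algebraMap_ne_zero h0),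
    mul_div_cancel₀ _ (algebraMap_ne_zero h0)⟩

/-- The coefficients of the Todd series. -/
noncomputable def toddCoeff (n : ℕ) : ℂ := PowerSeries.coeff n (toddTwist 1)

theorem one_div_one_sub_expMer {A : Ser} (hA : MvPowerSeries.constantCoeff A = 0) (h0 : A ≠ 0) :
    1 / (1 - expMer A) = algebraMap Ser Mer ((toddTwist 1).subst A) / algebraMap Ser Mer A := by
  have h := toddTwist_subst_mul hA 1
  rw [map_one, map_one, one_mul] at h
  rw [div_eq_div_iff (sub_ne_zero.mpr (expMer_ne_one hA h0).symm) (algebraMap_ne_zero h0), one_mul,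
    h]

theorem hasComponent_one_div {A : Ser} (hA : A.IsHomogeneous 1) (h0 : A ≠ 0) (n : ℕ) :
    HasComponent n (1 / (1 - expMer A))
      (algebraMap Ser Mer (MvPowerSeries.C (toddCoeff (n + 1)) * A ^ (n + 1)) /
        algebraMap Ser Mer A) := by
  rw [one_div_one_sub_expMer (constantCoeff_of_isHomogeneous_one hA) h0, toddCoeff,
    ← homogeneousComponent_subst hA]
  exact hasComponent_div hA h0 _

theorem hasComponent_toddF {A B : Ser} (hA : A.IsHomogeneous 1) (hB : B.IsHomogeneous 1)
    (hA0 : A ≠ 0) (hB0 : B ≠ 0) (n : ℕ) :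
    HasComponent n (toddF A B)
      (algebraMap Ser Mer (∑ p ∈ Finset.HasAntidiagonal.antidiagonal (n + 2),
        MvPowerSeries.C (toddCoeff p.1 * toddCoeff p.2) * (A ^ p.1 * B ^ p.2)) /
        algebraMap Ser Mer (A * B)) := by
  have h := hasComponent_div (n := n) (hA.mul hB) (mul_ne_zero hA0 hB0)
    ((toddTwist 1).subst A * (toddTwist 1).subst B)
  rw [toddF_eq, one_div_one_sub_expMer (constantCoeff_of_isHomogeneous_one hA) hA0,
    one_div_one_sub_expMer (constantCoeff_of_isHomogeneous_one hB) hB0, div_mul_div_comm,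
    ← map_mul, ← map_mul]
  convert h using 3
  rw [homogeneousComponent_mul]
  refine Finset.sum_congr rfl fun p _ => ?_
  rw [homogeneousComponent_subst hA, homogeneousComponent_subst hB, map_mul, toddCoeff, toddCoeff]
  ring

end Homogeneous

/-! ### Bernoulli numbers -/

/-- Both series give `S` when multiplied by `1 - exp(-S)`. The convention here is `B_1 = +1/2`. -/
theorem toddTwist_one : toddTwist 1 = bernoulli'PowerSeries ℂ := by
  have h1 := bernoulli'PowerSeries_mul_exp_sub_one ℂ
  have h2 := PowerSeries.exp_mul_exp_neg_eq_one (A := ℂ)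
  have h3 := toddTwist_mul_toddDenom 1
  have h0 : toddDenom 1 ≠ 0 := by
    intro h
    rw [h, mul_zero] at h3
    exact PowerSeries.X_ne_zero h3.symm
  apply mul_right_cancel₀ h0
  rw [h3, toddDenom, map_one, one_mul]
  linear_combination (bernoulli'PowerSeries ℂ - PowerSeries.X) * h2 -
    PowerSeries.evalNegHom (PowerSeries.exp ℂ) * h1

theorem toddCoeff_eq (n : ℕ) :
    toddCoeff n = ((bernoulli' n / (n.factorial : ℚ) : ℚ) : ℂ) := by
  rw [toddCoeff, toddTwist_one, bernoulli'PowerSeries, PowerSeries.coeff_mk, eq_ratCast]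

theorem toddCoeff_eq_bern {n : ℕ} (hn : n ≠ 1) : toddCoeff n = bern n := by
  rw [toddCoeff_eq, bern, bernoulli_eq_bernoulli'_of_ne_one hn]

theorem toddCoeff_zero : toddCoeff 0 = 1 := by
  rw [toddCoeff_eq]
  simp

theorem toddCoeff_one : toddCoeff 1 = 1 / 2 := by
  rw [toddCoeff_eq]
  simp

theorem toddCoeff_odd {k : ℕ} (hk : k ≠ 0) : toddCoeff (2 * k + 1) = 0 := by
  rw [toddCoeff_eq, bernoulli'_eq_zero_of_odd ⟨k, rfl⟩ (by omega)]
  simp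

/-- The sign of `B_1` is immaterial: for `k = 0` it enters squared, and for `k ≥ 1` it is paired
with `B_{2k+1} = 0`. -/
theorem toddCoeff_mul {k i : ℕ} (hi : i ∈ Finset.Icc 1 (2 * k + 1)) :
    toddCoeff i * toddCoeff (2 * k + 2 - i) = bern i * bern (2 * k + 2 - i) := by
  rw [Finset.mem_Icc] at hi
  rcases Nat.eq_zero_or_pos k with rfl | hk
  · have : i = 1 := by omega
    subst this
    rw [show 2 * 0 + 2 - 1 = 1 from rfl, toddCoeff_one, bern]
    norm_num
  · have hz := toddCoeff_odd hk.ne'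
    have hz' := toddCoeff_eq_bern (n := 2 * k + 1) (by omega)
    rw [hz] at hz'
    by_cases h1 : i = 1
    · subst h1
      rw [show 2 * k + 2 - 1 = 2 * k + 1 by omega, hz, ← hz', mul_zero, mul_zero]
    · by_cases h2 : i = 2 * k + 1
      · subst h2
        rw [hz, ← hz', zero_mul, zero_mul]
      · rw [toddCoeff_eq_bern h1, toddCoeff_eq_bern (by omega)]

/-- The two extreme terms are the only ones not divisible by `A B`; the others assemble into `L_k`.
-/
theorem sum_toddCoeff (k : ℕ) (A B : Ser) :
    ∑ p ∈ Finset.HasAntidiagonal.antidiagonal (2 * k + 2),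
        MvPowerSeries.C (toddCoeff p.1 * toddCoeff p.2) * (A ^ p.1 * B ^ p.2) =
      A * B * polyL k A B +
        MvPowerSeries.C (bern (2 * k + 2)) * (A ^ (2 * k + 2) + B ^ (2 * k + 2)) := by
  rw [Finset.Nat.sum_antidiagonal_eq_sum_range_succ
    (fun i j => MvPowerSeries.C (toddCoeff i * toddCoeff j) * (A ^ i * B ^ j)),
    Finset.sum_range_succ, Finset.sum_range_succ', Nat.sub_self, Nat.sub_zero, toddCoeff_zero,
    toddCoeff_eq_bern (show 2 * k + 2 ≠ 1 by omega), polyL, Finset.mul_sum, Finset.range_eq_Ico,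
    Finset.sum_Ico_add' (fun i : ℕ => MvPowerSeries.C (toddCoeff i * toddCoeff (2 * k + 2 - i)) *
      (A ^ i * B ^ (2 * k + 2 - i))) 0 (2 * k + 1) 1]
  have h : ∑ i ∈ Finset.Ico (0 + 1) (2 * k + 1 + 1),
      (MvPowerSeries.C (toddCoeff i * toddCoeff (2 * k + 2 - i)) *
        (A ^ i * B ^ (2 * k + 2 - i)) : Ser) =
      ∑ i ∈ Finset.Icc 1 (2 * k + 1), A * B *
        ((bern i * bern (2 * k + 2 - i)) • (A ^ (i - 1) * B ^ (2 * k + 1 - i))) := by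
    refine Finset.sum_congr rfl fun i hi => ?_
    rw [toddCoeff_mul hi, MvPowerSeries.smul_eq_C_mul]
    have hi' := Finset.mem_Icc.mp hi
    obtain ⟨j, rfl⟩ := Nat.exists_eq_add_of_le' hi'.1
    obtain ⟨l, hl⟩ := Nat.exists_eq_add_of_le hi'.2
    rw [show 2 * k + 2 - (j + 1) = l + 1 by omega, show 2 * k + 1 - (j + 1) = l by omega,
      Nat.add_sub_cancel]
    ring
  rw [h]
  simp only [pow_zero, mul_one, one_mul]
  ring

/-! ### The homogeneous components of the Todd series -/

/-- Group by denominator. Over `m (n + 1)` stands `m n ^ e - m (n + 2) ^ e`, divisible by `m n - m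
(n + 2) = c n * m (n + 1)`, so the denominator cancels. Only the first and last denominators remain.
-/
theorem alternating_sum_div {F : Type*} [Field F] (m c : ℕ → F) (hm : ∀ n, m n ≠ 0)
    (hrec : ∀ n, m (n + 2) = m n - c n * m (n + 1)) (e ℓ : ℕ) :
    ∑ n ∈ Finset.range (ℓ + 1), -((-1) ^ n * (m (n + 1) ^ e / m n + m n ^ e / m (n + 1))) =
      -(m 1 ^ e / m 0) + (-1) ^ (ℓ + 1) * (m ℓ ^ e / m (ℓ + 1)) +
        ∑ n ∈ Finset.range ℓ, (-1) ^ (n + 1) * c n *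
          ∑ j ∈ Finset.range e, m n ^ (e - 1 - j) * m (n + 2) ^ j := by
  induction ℓ with
  | zero =>
    simp
    ring
  | succ ℓ ih =>
    rw [Finset.sum_range_succ, ih, Finset.sum_range_succ _ ℓ]
    have h1 := geom_sum₂_mul (m (ℓ + 2)) (m ℓ) e
    have h2 : ∑ j ∈ Finset.range e, m (ℓ + 2) ^ j * m ℓ ^ (e - 1 - j) =
        ∑ j ∈ Finset.range e, m ℓ ^ (e - 1 - j) * m (ℓ + 2) ^ j :=
      Finset.sum_congr rfl fun _ _ => mul_comm _ _
    rw [h2, hrec ℓ, sub_sub_cancel_left, ← hrec ℓ] at h1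
    generalize ∑ j ∈ Finset.range e, m ℓ ^ (e - 1 - j) * m (ℓ + 2) ^ j = R at *
    have h3 : c ℓ * R = (m ℓ ^ e - m (ℓ + 2) ^ e) / m (ℓ + 1) := by
      rw [eq_div_iff (hm _)]
      linear_combination -h1
    rw [mul_assoc ((-1) ^ (ℓ + 1)) (c ℓ), h3]
    ring

section ToddSum

variable {a : ℕ → ℕ} {ℓ : ℕ}

theorem isHomogeneous_natCast_mul {f : Ser} {d : ℕ} (hf : f.IsHomogeneous d) (c : ℕ) :
    ((c : Ser) * f).IsHomogeneous d := by
  rw [show (c : Ser) = MvPowerSeries.C (c : ℂ) by simp]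
  exact isHomogeneous_C_mul hf _

theorem isHomogeneous_endForm : (endForm a ℓ).IsHomogeneous 1 :=
  isHomogeneous_natCast_mul (isHomogeneous_X 1) _

theorem isHomogeneous_baseForm : (baseForm a ℓ).IsHomogeneous 1 := by
  rw [baseForm, sub_eq_add_neg, show -((cfDen (revSeq a ℓ) ℓ : Ser) * MvPowerSeries.X 1) =
    MvPowerSeries.C (-(cfDen (revSeq a ℓ) ℓ : ℂ)) * MvPowerSeries.X 1 by simp]
  exact MvPowerSeries.IsHomogeneous.add (isHomogeneous_X 0) (isHomogeneous_C_mul (isHomogeneous_X 1) _)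

theorem isHomogeneous_cfM (n : ℕ) : (cfM a ℓ ((n : ℤ) - 1)).IsHomogeneous 1 := by
  rw [cfM_sub_one, show ((-1 : Ser) ^ n) = MvPowerSeries.C ((-1 : ℂ) ^ n) by simp]
  exact isHomogeneous_C_mul (MvPowerSeries.IsHomogeneous.add
    (isHomogeneous_natCast_mul isHomogeneous_baseForm _)
    (isHomogeneous_natCast_mul isHomogeneous_endForm _)) _

/-- The alternating sign in `M_i` turns the additive convergent recursion into a subtraction. -/
theorem cfM_recurrence (n : ℕ) :
    cfM a ℓ (((n + 2 : ℕ) : ℤ) - 1) =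
      cfM a ℓ ((n : ℤ) - 1) - (revSeq a ℓ n : Ser) * cfM a ℓ (((n + 1 : ℕ) : ℤ) - 1) := by
  simp only [cfM_sub_one, cfNum, cfDen]
  push_cast
  ring

theorem endForm_eq_cfM : endForm a ℓ = cfM a ℓ (((0 : ℕ) : ℤ) - 1) := by
  rw [cfM_sub_one]
  simp [cfNum, cfDen]

theorem cfM_last (hℓ : Even ℓ) :
    cfM a ℓ ((ℓ : ℤ) - 1) = (cfNum (revSeq a ℓ) ℓ : Ser) * MvPowerSeries.X 0 := by
  rw [cfM_sub_one, hℓ.neg_one_pow, baseForm, endForm]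
  ring

/-- Degree `2k` is taken because the prefactor `α_{ℓ-1} x₁ x₂` has degree two. The individual
components still have denominators; they are removed only after summation. -/
theorem hasComponent_cfM_sum (hb : ∀ n, 0 < revSeq a ℓ n) (hℓ : ℓ ≠ 0) (k : ℕ) :
    HasComponent (2 * k) (∑ n ∈ Finset.range ℓ, -((-1 : Mer) ^ n *
        toddF (cfM a ℓ ((n : ℤ) - 1)) (cfM a ℓ n)) + 1 / (1 - expMer (endForm a ℓ)))
      (∑ n ∈ Finset.range ℓ, -((-1 : Mer) ^ n *
        (algebraMap Ser Mer (polyL k (cfM a ℓ n) (cfM a ℓ ((n : ℤ) - 1))) +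
          algebraMap Ser Mer (MvPowerSeries.C (bern (2 * k + 2))) *
            (algebraMap Ser Mer (cfM a ℓ n) ^ (2 * k + 1) /
                algebraMap Ser Mer (cfM a ℓ ((n : ℤ) - 1)) +
              algebraMap Ser Mer (cfM a ℓ ((n : ℤ) - 1)) ^ (2 * k + 1) /
                algebraMap Ser Mer (cfM a ℓ n)))) +
        algebraMap Ser Mer (MvPowerSeries.C (toddCoeff (2 * k + 1))) *
          algebraMap Ser Mer (endForm a ℓ) ^ (2 * k)) := by
  have hhom (n : ℕ) : MvPowerSeries.IsHomogeneous (cfM a ℓ (n : ℤ)) 1 := by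
    have h : MvPowerSeries.IsHomogeneous (cfM a ℓ (((n + 1 : ℕ) : ℤ) - 1)) 1 :=
      isHomogeneous_cfM (n + 1)
    rwa [Nat.cast_add, Nat.cast_one, add_sub_cancel_right] at h
  have hne (n : ℕ) : cfM a ℓ (n : ℤ) ≠ 0 := by
    have h := cfM_ne_zero a ℓ hb hℓ (n + 1)
    rwa [Nat.cast_add, Nat.cast_one, add_sub_cancel_right] at h
  have hend : endForm a ℓ ≠ 0 := by
    rw [endForm_eq_cfM]
    exact cfM_ne_zero a ℓ hb hℓ 0
  have h2 := hasComponent_one_div isHomogeneous_endForm hend (2 * k)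
  have e2 := algebraMap_ne_zero hend
  rw [map_mul, map_pow, pow_succ, ← mul_assoc, mul_div_cancel_right₀ _ e2] at h2
  refine HasComponent.add (HasComponent.sum _ fun n _ => ?_) h2
  have h1 := hasComponent_toddF (hhom n) (isHomogeneous_cfM n) (hne n)
    (cfM_ne_zero a ℓ hb hℓ n) (2 * k)
  have hC : MvPowerSeries.IsHomogeneous (-(-1 : Ser) ^ n) 0 := by
    have h : MvPowerSeries.IsHomogeneous (MvPowerSeries.C (-(-1 : ℂ) ^ n) *
        (MvPowerSeries.X 0 : Ser) ^ 0) (1 * 0) :=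
      isHomogeneous_C_mul (IsHomogeneous.pow (isHomogeneous_X 0) 0) _
    rwa [pow_zero, mul_one, mul_zero, map_neg, map_pow, map_neg, map_one] at h
  have h3 : HasComponent (2 * k) _ _ := h1.mul_left hC
  rw [sum_toddCoeff, toddF_comm] at h3
  convert h3 using 1
  · simp
  · have ea := algebraMap_ne_zero (hne n)
    have eb := algebraMap_ne_zero (cfM_ne_zero a ℓ hb hℓ n)
    simp only [map_neg, map_mul, map_add, map_pow, map_one, neg_mul]
    congr 2
    field_simp
    ring

/-- Apply `alternating_sum_div` with exponent `2k + 1` to `M_{-1}, M_0, …`. The surviving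
denominators `α_{ℓ-1} x₂` and `α_{ℓ-1} x₁` cancel against the prefactor and leave the boundary terms
in `M_0` and `M_{ℓ-2}`. -/
theorem homogeneousComponent_todd_dual (hb : ∀ n, 0 < revSeq a ℓ n) (hℓ : ℓ ≠ 0) (hev : Even ℓ)
    (k : ℕ) :
    MvPowerSeries.homogeneousComponent (2 * k + 2) (todd (idealCone a ℓ).dual) =
      (cfNum (revSeq a ℓ) ℓ : Ser) *
        (∑ n ∈ Finset.range ℓ, -((-1 : Ser) ^ n *
            (polyL k (cfM a ℓ n) (cfM a ℓ ((n : ℤ) - 1)) * MvPowerSeries.X 0 * MvPowerSeries.X 1)) +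
          ∑ n ∈ Finset.range (ℓ - 1),
            ((-1 : Ser) ^ (n + 1) * (revSeq a ℓ n : Ser) * MvPowerSeries.C (bern (2 * k + 2))) *
              (polyR k (cfM a ℓ ((n : ℤ) - 1)) (cfM a ℓ ((n : ℤ) + 1)) *
                MvPowerSeries.X 0 * MvPowerSeries.X 1)) +
      MvPowerSeries.C (bern (2 * k + 2)) *
        (-(MvPowerSeries.X 0 * cfM a ℓ 0 ^ (2 * k + 1)) +
          MvPowerSeries.X 1 * cfM a ℓ ((ℓ : ℤ) - 2) ^ (2 * k + 1)) +
      (if k = 0 then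
        MvPowerSeries.C (1 / 2 : ℂ) *
          ((cfNum (revSeq a ℓ) ℓ : Ser) * MvPowerSeries.X 0 * MvPowerSeries.X 1)
        else 0) := by
  have hp : MvPowerSeries.IsHomogeneous
      ((cfNum (revSeq a ℓ) ℓ : Ser) * MvPowerSeries.X 0 * MvPowerSeries.X 1) 2 := by
    rw [mul_assoc]
    exact isHomogeneous_natCast_mul (MvPowerSeries.IsHomogeneous.mul (isHomogeneous_X 0)
      (isHomogeneous_X 1)) _
  have h := (hasComponent_cfM_sum hb hℓ k).mul_left hp
  rw [← algebraMap_todd_dual_eq_cfM_sum hb hℓ] at h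
  apply IsFractionRing.injective Ser Mer
  rw [h.eq_homogeneousComponent]
  clear h hp
  have hM (n : ℕ) : algebraMap Ser Mer (cfM a ℓ ((n : ℤ) - 1)) ≠ 0 :=
    algebraMap_ne_zero (cfM_ne_zero a ℓ hb hℓ n)
  have hrec (n : ℕ) := congrArg (algebraMap Ser Mer) (cfM_recurrence (a := a) (ℓ := ℓ) n)
  simp only [map_sub, map_mul, map_natCast] at hrec
  obtain ⟨l, rfl⟩ := Nat.exists_eq_succ_of_ne_zero hℓ
  have hs := alternating_sum_div (fun n : ℕ => algebraMap Ser Mer (cfM a (l + 1) ((n : ℤ) - 1)))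
    (fun n => (revSeq a (l + 1) n : Mer)) hM hrec (2 * k + 1) l
  have e0 := congrArg (algebraMap Ser Mer) (endForm_eq_cfM (a := a) (ℓ := l + 1))
  have e1 := congrArg (algebraMap Ser Mer) (cfM_last (a := a) hev)
  have hend : algebraMap Ser Mer (endForm a (l + 1)) =
      (cfNum (revSeq a (l + 1)) (l + 1) : Mer) * algebraMap Ser Mer (MvPowerSeries.X 1) := by
    rw [endForm, map_mul, map_natCast]
  have hN : (cfNum (revSeq a (l + 1)) (l + 1) : Mer) ≠ 0 := by
    have h := hM 0
    rw [← e0, hend] at h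
    exact left_ne_zero_of_mul h
  have hx := algebraMap_ne_zero (X_ne_zero 0)
  have hy := algebraMap_ne_zero (X_ne_zero 1)
  -- The term `1/(1 - exp(-α_{ℓ-1} x₂))` contributes an odd-index Todd coefficient, which vanishes
  -- unless `k = 0`.
  have hlast : algebraMap Ser Mer (if k = 0 then MvPowerSeries.C (1 / 2 : ℂ) *
      ((cfNum (revSeq a (l + 1)) (l + 1) : Ser) * MvPowerSeries.X 0 * MvPowerSeries.X 1) else 0) =
      algebraMap Ser Mer (MvPowerSeries.C (toddCoeff (2 * k + 1))) *
          algebraMap Ser Mer (endForm a (l + 1)) ^ (2 * k) *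
        ((cfNum (revSeq a (l + 1)) (l + 1) : Mer) * algebraMap Ser Mer (MvPowerSeries.X 0) *
          algebraMap Ser Mer (MvPowerSeries.X 1)) := by
    split_ifs with hk
    · subst hk
      rw [mul_zero, zero_add, toddCoeff_one, pow_zero, mul_one, map_mul, map_mul, map_mul,
        map_natCast]
    · rw [toddCoeff_odd hk]
      simp
  simp only [Nat.succ_eq_add_one, Nat.add_sub_cancel] at *
  rw [map_add, map_add, hlast]
  rw [map_mul, map_natCast] at e1
  simp only [Nat.cast_add, Nat.cast_one, Nat.cast_zero, Nat.cast_ofNat, add_sub_cancel_right,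
    zero_sub, sub_self,
    show ∀ n : ℤ, n + 2 - 1 = n + 1 from fun n => by ring] at hs e1 e0
  rw [hev.neg_one_pow, ← e0, hend, e1] at hs
  have hsplit (A B : ℕ → Mer) (b : Mer) : ∑ n ∈ Finset.range (l + 1), -((-1) ^ n * (A n + b * B n)) =
      ∑ n ∈ Finset.range (l + 1), -((-1) ^ n * A n) +
        b * ∑ n ∈ Finset.range (l + 1), -((-1) ^ n * B n) := by
    rw [Finset.mul_sum, ← Finset.sum_add_distrib]
    exact Finset.sum_congr rfl fun n _ => by ring
  rw [hsplit, hs]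
  have hL : algebraMap Ser Mer (∑ n ∈ Finset.range (l + 1), -((-1 : Ser) ^ n *
        (polyL k (cfM a (l + 1) n) (cfM a (l + 1) ((n : ℤ) - 1)) * MvPowerSeries.X 0 *
          MvPowerSeries.X 1))) =
      algebraMap Ser Mer (MvPowerSeries.X 0) * algebraMap Ser Mer (MvPowerSeries.X 1) *
        ∑ n ∈ Finset.range (l + 1), -((-1 : Mer) ^ n * algebraMap Ser Mer
          (polyL k (cfM a (l + 1) n) (cfM a (l + 1) ((n : ℤ) - 1)))) := by
    rw [map_sum, Finset.mul_sum]
    refine Finset.sum_congr rfl fun n _ => ?_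
    simp only [map_neg, map_mul, map_pow, map_one]
    ring
  have hR : algebraMap Ser Mer (∑ n ∈ Finset.range l,
        ((-1 : Ser) ^ (n + 1) * (revSeq a (l + 1) n : Ser) * MvPowerSeries.C (bern (2 * k + 2))) *
          (polyR k (cfM a (l + 1) ((n : ℤ) - 1)) (cfM a (l + 1) ((n : ℤ) + 1)) *
            MvPowerSeries.X 0 * MvPowerSeries.X 1)) =
      algebraMap Ser Mer (MvPowerSeries.X 0) * algebraMap Ser Mer (MvPowerSeries.X 1) *
        algebraMap Ser Mer (MvPowerSeries.C (bern (2 * k + 2))) *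
        ∑ n ∈ Finset.range l, (-1 : Mer) ^ (n + 1) * (revSeq a (l + 1) n : Mer) *
          ∑ j ∈ Finset.range (2 * k + 1),
            algebraMap Ser Mer (cfM a (l + 1) ((n : ℤ) - 1)) ^ (2 * k + 1 - 1 - j) *
              algebraMap Ser Mer (cfM a (l + 1) ((n : ℤ) + 1)) ^ j := by
    rw [map_sum, Finset.mul_sum]
    refine Finset.sum_congr rfl fun n _ => ?_
    simp only [polyR, map_neg, map_mul, map_pow, map_one, map_natCast, map_sum,
      Nat.add_sub_cancel]
    ring
  simp only [map_mul, map_add, map_neg, map_pow, map_natCast] at hL hR ⊢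
  rw [hL, hR, show ((l + 1 : ℕ) : ℤ) - 2 = (l : ℤ) - 1 by push_cast; ring]
  simp only [Nat.add_sub_cancel]
  generalize ∑ n ∈ Finset.range (l + 1), -((-1 : Mer) ^ n * _) = SL
  generalize ∑ n ∈ Finset.range l, (_ : Mer) = SR
  field_simp
  ring

end ToddSum

/-! ### Positivity of the partial quotients, and the main theorem -/

theorem IsPurelyPeriodicCF.pos {x : ℝ} {a : ℕ → ℕ} {r : ℕ} (h : IsPurelyPeriodicCF x a r) (n : ℕ) :
    0 < a n := by
  have hs (m : ℕ) : 0 < a (m + 1) := by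
    have h1 := GenContFract.of_one_le_get?_partDen (h.2.1 m)
    have h2 : 1 ≤ a (m + 1) := by exact_mod_cast h1
    exact h2
  cases n with
  | zero =>
    obtain ⟨⟨hr, hper⟩, -⟩ := h.2.2
    -- The integer part of a continued fraction may be nonpositive in general; periodicity
    -- identifies `a 0` with the later partial quotient `a r`.
    rw [← hper 0, zero_add, ← Nat.succ_pred_eq_of_pos hr]
    exact hs _
  | succ n => exact hs n

end ConeTodd

theorem mainTheorem4
    (K : Type*) [Field K] [NumberField K] (hK : Module.finrank ℚ K = 2) (ι : K →+* ℝ)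
    (𝔟 : Ideal (NumberField.RingOfIntegers K)) (ω : K)
    (h𝔟 : ∀ x : K,
      x ∈ (𝔟 : FractionalIdeal (nonZeroDivisors (NumberField.RingOfIntegers K)) K)⁻¹ ↔
        ∃ m n : ℤ, x = m + n * ω)
    (a : ℕ → ℕ) (r : ℕ) (hω : IsPurelyPeriodicCF (ι ω) a r)
    (ℓ : ℕ) (hℓ : ℓ = if Even r then r else 2 * r) :
    -- the cone `σ`, its dual, and the decomposition of the dual into nonsingular cones
    ((idealCone a ℓ).IsLatticeCone ∧ (idealCone a ℓ).dual.IsLatticeCone ∧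
      (idealCone a ℓ).dual.Similar (tauCone a ℓ) ∧
      (∀ i : Fin ℓ, (piece a ℓ i).IsNonsingular) ∧
      IsVirtualSum (tauCone a ℓ) (fun i : Fin ℓ => piece a ℓ i) ∧
      normTodd (idealCone a ℓ).dual =
        toddF (changeCoords (piece a ℓ 0) (tauCone a ℓ) 0)
            (changeCoords (piece a ℓ 0) (tauCone a ℓ) 1) +
          ∑ i ∈ Finset.Icc 1 (ℓ - 1), (-1 : Mer) ^ (i - 1) *
            toddF (changeCoords (piece a ℓ i) (tauCone a ℓ) 0)
              (changeCoords (piece a ℓ i) (tauCone a ℓ) 1)) ∧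
    -- the Todd series in terms of the linear forms `M_i`
    algebraMap Ser Mer (todd (idealCone a ℓ).dual) =
      algebraMap Ser Mer
          ((cfα a ℓ (ℓ - 1) : Ser) * MvPowerSeries.X 0 * MvPowerSeries.X 1) *
        (∑ i ∈ Finset.Icc (-1 : ℤ) (ℓ - 2),
            (-1 : Mer) ^ i * toddF (cfM a ℓ i) (cfM a ℓ (i + 1)) +
          1 / algebraMap Ser Mer
            (1 - (PowerSeries.exp ℂ).subst
              (-((cfα a ℓ (ℓ - 1) : Ser) * MvPowerSeries.X 1)))) ∧
    -- its homogeneous part of degree `2k + 2`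
    ∀ k : ℕ,
      MvPowerSeries.homogeneousComponent (2 * k + 2) (todd (idealCone a ℓ).dual) =
        (cfα a ℓ (ℓ - 1) : Ser) *
          (∑ i ∈ Finset.Icc (-1 : ℤ) (ℓ - 2),
              ((-1 : ℂ) ^ i) • (polyL k (cfM a ℓ (i + 1)) (cfM a ℓ i) *
                MvPowerSeries.X 0 * MvPowerSeries.X 1) +
            ∑ i ∈ Finset.Icc 1 (ℓ - 1),
              ((-1 : ℂ) ^ i * (a (ℓ - i) : ℂ) * bern (2 * k + 2)) •
                (polyR k (cfM a ℓ ((i : ℤ) - 2)) (cfM a ℓ i) *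
                  MvPowerSeries.X 0 * MvPowerSeries.X 1)) +
        bern (2 * k + 2) •
          (-(MvPowerSeries.X 0 * cfM a ℓ 0 ^ (2 * k + 1)) +
            MvPowerSeries.X 1 * cfM a ℓ ((ℓ : ℤ) - 2) ^ (2 * k + 1)) +
        (if k = 0 then
          (1 / 2 : ℂ) • ((cfα a ℓ (ℓ - 1) : Ser) * MvPowerSeries.X 0 * MvPowerSeries.X 1)
          else 0) := by
  obtain ⟨hr, -⟩ := hω.2.2.1
  have hev : Even ℓ := by
    rw [hℓ]
    split_ifs with h
    · exact h
    · exact even_two_mul r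
  have hℓ0 : ℓ ≠ 0 := by
    rw [hℓ]
    split_ifs <;> omega
  have hb (n : ℕ) : 0 < revSeq a ℓ n := hω.pos _
  have hN : 0 < cfNum (revSeq a ℓ) ℓ := by
    obtain ⟨k, rfl⟩ := Nat.exists_eq_succ_of_ne_zero hℓ0
    exact cfNum_pos hb k
  have hα : (cfα a ℓ (ℓ - 1) : Ser) = (cfNum (revSeq a ℓ) ℓ : Ser) := by
    rw [cfα_sub_one, Int.cast_natCast]
  refine ⟨⟨idealCone_isLatticeCone a ℓ hN, idealCone_dual_isLatticeCone a ℓ hN,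
    idealCone_dual_similar a ℓ hN, fun i => piece_isNonsingular a ℓ i,
    tauCone_isVirtualSum a ℓ hb hℓ0, normTodd_dual hb hℓ0⟩, ?_, fun k => ?_⟩
  · rw [algebraMap_todd_dual_eq_cfM_sum hb hℓ0, sum_Icc_neg_one, hα]
    congr 2
    · refine Finset.sum_congr rfl fun n _ => ?_
      -- With `i = n - 1`, the integer power `(-1)^i` is `-(-1)^n`.
      rw [sub_add_cancel, zpow_sub_one₀ (neg_ne_zero.mpr one_ne_zero), zpow_natCast,
        inv_eq_of_mul_eq_one_left (neg_mul_neg (1 : Mer) 1 |>.trans (one_mul 1))]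
      ring
    · rw [expMer, map_sub, map_one, endForm]
  · rw [homogeneousComponent_todd_dual hb hℓ0 hev, sum_Icc_neg_one, hα, MvPowerSeries.smul_eq_C_mul]
    congr 3
    · congr 1
      · refine Finset.sum_congr rfl fun n _ => ?_
        rw [sub_add_cancel, zpow_sub_one₀ (neg_ne_zero.mpr one_ne_zero), zpow_natCast,
          MvPowerSeries.smul_eq_C_mul]
        simp
      -- Reindexing by `i = n + 1`, where `revSeq a ℓ n` is `a (ℓ - i)`.
      · rw [Finset.range_eq_Ico]
        have hs := Finset.sum_Ico_add' (fun i : ℕ => ((-1 : ℂ) ^ i * (a (ℓ - i) : ℂ) *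
          bern (2 * k + 2)) • (polyR k (cfM a ℓ ((i : ℤ) - 2)) (cfM a ℓ i) *
                MvPowerSeries.X 0 * MvPowerSeries.X 1)) 0 (ℓ - 1) 1
        refine Eq.trans ?_ hs
        refine Finset.sum_congr rfl fun n _ => ?_
        rw [MvPowerSeries.smul_eq_C_mul, Nat.cast_add, Nat.cast_one,
          show (n : ℤ) + 1 - 2 = n - 1 by ring]
        simp [revSeq]
    · exact (MvPowerSeries.smul_eq_C_mul _ _).symm
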